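/- **Setting.** Let $G=(V,E)$ be a finite directed graph with $n=|V|$, activation probabilities $p:E\to[0,1]$, and a seed set $T\subseteq V$. Let $n'=|V\setminus T|$, let $G'=(V,E')$ be $G$ without the edges pointing to nodes of $T$, and let $m'=|E'|$. Fix a termination time $K\in\mathbb N$ ($K\ge n'$ means: until no new node is activated). In the independent cascade model each newly activated node $u$ has, in the next step, one chance to activate each inactive out-neighbour $v$, with probability $p(u,v)$, independently. For $S\subseteq V$ let $U(S)$ be the expected number of nodes of $V\setminus T$ that are active after $K$ steps of the cascade started from $S$ in the graph obtained from $G$ by deleting the nodes of $T\setminus S$ with all their edges. For $t\in T$ let $$Shap(t)=\sum_{S\subseteq T\setminus\{t\}}\frac{|S|!\,(|T|-|S|-1)!}{|T|!}\,\bigl(U(S\cup\{t\})-U(S)\bigr),$$ and let $Shap^{(k)}$ be the $k$-th largest of the values $Shap(t)$, $t\in T$. Let $\tilde v$ be a random node of $V\setminus T$ drawn with probability proportional to its in-degree in $G'$. **Algorithm** $\mathsf{ApproxRRset}$ with parameters $\varepsilon,\ell>0$, $1\le k\le|T|$. A random RR set $R$ is generated by drawing a root uniformly from $V\setminus T$,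 keeping each edge $e$ of $G'$ independently with probability $p(e)$, and collecting by backward breadth-first search all nodes from which the root can be reached along at most $K$ kept edges. Crediting $R$ means adding $1/|R\cap T|$ to a counter $est_t$ for each $t\in R\cap T$. Let $est^{(k)}$ be the $k$-th largest counter. *Phase 1.* Put $\varepsilon'=\sqrt2\,\varepsilon$, $LB=1$, $\theta_0=0$, $est=0$. For $i=1,\dots,\lfloor\log_2 n'\rfloor-1$: put $x_i=n'/2^i$ and $$\theta_i=\Bigl\lceil \tfrac{n'(2+\frac23\varepsilon')}{\varepsilon'^2x_i}\bigl(\ell\ln n'+\ln|T|+\ln\log_2n'+\ln2\bigr)\Bigr\rceil,$$ generate and credit $\theta_i-\theta_{i-1}$ new RR sets; if $n'est^{(k)}/\theta_i\ge(1+\varepsilon')x_i$, put $LB=n'est^{(k)}/(\theta_i(1+\varepsilon'))$ and leave the loop. *Phase 2.* Put $\theta=\bigl\lceil \frac{n'(2+\frac23\varepsilon)}{\varepsilon^2LB}(\ell\ln n'+\ln|T|+\ln4)\bigr\rceil$, reset the counters, generate and credit $\theta$ new RR sets, and return $n'est_t/\theta$ for all $t\in T$. **Running time.** One step is counted for drawing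 a root, for each node expanded by a search, for each edge of $G'$ pointing to an expanded node (its coin is inspected only then), and for each node of an RR set when the set is credited. The searches run on $G$ itself, so $G'$ is not written out, and the counters are stored sparsely: start-up and each reset cost one step, and selecting the $k$-th largest or writing the counters out costs one step plus one per nonzero counter. **Proposition.** For all $\varepsilon_0,\ell_0,c>0$ there is a constant $C>0$, depending only on these, such that the following holds for every such instance with $0<\varepsilon\le\varepsilon_0$, $\ell\ge\ell_0$, $1\le k\le |T|$, $n'\ge2$, $Shap^{(k)}>0$ and $$\ell\ \ge\ \frac{\log_2k-\log_2\log_2n'+\log_2n'-\log_2|T|}{\log_2n'} .$$ The expected running time of $\mathsf{ApproxRRset}$ is at most $$C\cdot\frac{n\,\ell\,\log n}{Shap^{(k)}\,\varepsilon^2}\cdot\Bigl(\frac{m'}{n'}\,\mathbb E_{\tilde v}\bigl[U(\{\tilde v\})\bigr]+1\Bigr),$$ and if moreover $m'\ge c\,n'$, then it is at most $$C\cdot\frac{n\,\ell\,\log n}{Shap^{(k)}\,\varepsilon^2}\cdot\frac{m'}{n'}\cdot\mathbb E_{\tilde v}\bigl[U(\{\tilde v\})\bigr].$$ -/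

import Mathlib

open scoped NNReal ENNReal

universe u

/-! ### Networks, the independent cascade model, Shapley values -/

/-- A directed network on the node set `V`: a set of directed edges `(u, v)` (from `u` to `v`)
with an activation probability in `[0, 1]` on every edge. -/
structure Network (V : Type*) [Fintype V] [DecidableEq V] where
  edges : Finset (V × V)
  prob : V × V → ℝ≥0
  prob_le_one : ∀ e ∈ edges, prob e ≤ 1

namespace Network

variable {V : Type*} [Fintype V] [DecidableEq V]

/-- The subnetwork that keeps the edges satisfying `P`, with their probabilities. -/
def keep (G : Network V) (P : V × V → Prop) [DecidablePred P] : Network V where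
  edges := G.edges.filter P
  prob := G.prob
  prob_le_one := fun e he => G.prob_le_one e (Finset.mem_filter.mp he).1

/-- The number of edges of `G` that point to `v`. -/
def inDegree (G : Network V) (v : V) : ℕ := (G.edges.filter fun e => e.2 = v).card

/-- The probability that exactly the edges in `L` are live, when every edge `e` is live with
probability `prob e` independently of the others. -/
noncomputable def liveWeight (G : Network V) (L : Finset (V × V)) : ℝ≥0∞ :=
  if L ∈ G.edges.powerset then
    (∏ e ∈ L, (G.prob e : ℝ≥0∞)) * ∏ e ∈ G.edges \ L, (1 - (G.prob e : ℝ≥0∞))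
  else 0

theorem sum_liveWeight (G : Network V) : ∑ L ∈ G.edges.powerset, G.liveWeight L = 1 := by
  have h : ∑ L ∈ G.edges.powerset, G.liveWeight L
      = ∑ L ∈ G.edges.powerset,
        (∏ e ∈ L, (G.prob e : ℝ≥0∞)) * ∏ e ∈ G.edges \ L, (1 - (G.prob e : ℝ≥0∞)) :=
    Finset.sum_congr rfl fun L hL => if_pos hL
  rw [h, ← Finset.prod_add]
  refine Finset.prod_eq_one fun e he => ?_
  exact add_tsub_cancel_of_le (by exact_mod_cast G.prob_le_one e he)

theorem liveWeight_eq_zero (G : Network V) (L : Finset (V × V)) (hL : L ∉ G.edges.powerset) :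
    G.liveWeight L = 0 := if_neg hL

/-- The random live-edge graph of `G` (its set of live edges). -/
noncomputable def live (G : Network V) : PMF (Finset (V × V)) :=
  PMF.ofFinset G.liveWeight G.edges.powerset G.sum_liveWeight G.liveWeight_eq_zero

theorem live_apply (G : Network V) (L : Finset (V × V)) : G.live L = G.liveWeight L := rfl

/-- The independent cascade started from `S`, driven by the independent activation coins: `L` is
the set of edges whose (single) activation attempt succeeds if it takes place. The state after `τ`
steps is the pair (active nodes, nodes newly activated in step `τ`): in every step each newly
activated node `u` has one attempt on each of its inactive out-neighbours `v`. -/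
def cascade (L : Finset (V × V)) (S : Finset V) : ℕ → Finset V × Finset V
  | 0 => (S, S)
  | τ + 1 =>
    let A := (cascade L S τ).1
    let N := (cascade L S τ).2
    let new := Finset.univ.filter fun v => v ∉ A ∧ ∃ u ∈ N, (u, v) ∈ L
    (A ∪ new, new)

/-- The value function `U(S)` for the seed set `T` and termination after `K` steps: the expected
number of nodes outside `T` that are active after `K` steps of the cascade started from `S` in the
subnetwork in which all nodes of `T \ S`, with all their incoming and outgoing edges, are removed.
(It is applied to sets `S ⊆ T` and to single nodes outside `T`.) -/
noncomputable def value (G : Network V) (T : Finset V) (K : ℕ) (S : Finset V) : ℝ :=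
  let H := G.keep fun e => e.1 ∉ T \ S ∧ e.2 ∉ T \ S
  ∑ L ∈ H.edges.powerset, (H.live L).toReal * (((cascade L S K).1 \ T).card : ℝ)

/-- The Shapley value of the seed node `t`. -/
noncomputable def shapley (G : Network V) (T : Finset V) (K : ℕ) (t : V) : ℝ :=
  ∑ S ∈ (T.erase t).powerset,
    ((S.card.factorial * (T.card - S.card - 1).factorial : ℕ) : ℝ) / (T.card.factorial : ℝ)
      * (G.value T K (insert t S) - G.value T K S)

end Network

/-- The `k`-th largest value (`1 ≤ k ≤ |T|`, with multiplicity) of `f` on `T`. -/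
noncomputable def kthLargest {V : Type*} (T : Finset V) (f : V → ℝ) (k : ℕ) : ℝ :=
  ((T.val.map f).sort (· ≥ ·)).getD (k - 1) 0

/-! ### Randomized computations with a step counter -/

/-- A randomized computation: the joint law of its result and of the number of steps it takes. -/
abbrev Comp (α : Type*) := PMF (α × ℕ)

namespace Comp

variable {α β : Type*}

/-- Return `a` at no cost. -/
noncomputable def ret (a : α) : Comp α := PMF.pure (a, 0)

/-- Spend `c` further steps. -/
noncomputable def tick (c : ℕ) (x : Comp α) : Comp α := PMF.map (fun r => (r.1, c + r.2)) x

/-- Run `x`, then run `f` on its result with fresh randomness; the step counts add up. -/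
noncomputable def andThen (x : Comp α) (f : α → Comp β) : Comp β :=
  PMF.bind x fun r => tick r.2 (f r.1)

/-- The expected number of steps. -/
noncomputable def expectedSteps (x : Comp α) : ℝ≥0∞ := ∑' r : α × ℕ, x r * (r.2 : ℝ≥0∞)

end Comp

/-! ### The algorithm -/

/-- An input network with its seed set `seeds`, the number `depth` of steps after which the
diffusion stops, and at least one non-seed node. A `depth` of at least the number of non-seed nodes
means that the diffusion runs until no new node is activated. -/
structure Attribution (V : Type*) [Fintype V] [DecidableEq V] where
  net : Network V
  seeds : Finset V
  depth : ℕ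
  exists_nonseed : (Finset.univ \ seeds).Nonempty

namespace Attribution

variable {V : Type*} [Fintype V] [DecidableEq V] (I : Attribution V)

/-- The network without the edges that point to seed nodes. -/
def modified : Network V := I.net.keep fun e => e.2 ∉ I.seeds

/-- The number `n'` of non-seed nodes. -/
def nonseedCount : ℕ := (Finset.univ \ I.seeds).card

/-- The number `m'` of edges of the modified network. -/
def edgeCount : ℕ := I.modified.edges.card

/-- The value function of a set of nodes. -/
noncomputable def value (S : Finset V) : ℝ := I.net.value I.seeds I.depth S

/-- The `k`-th largest Shapley value of a seed node. -/
noncomputable def shapleyKth (k : ℕ) : ℝ :=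
  kthLargest I.seeds (I.net.shapley I.seeds I.depth) k

/-- The expected value of `U({v})` for a random non-seed node `v` drawn with probability
proportional to its in-degree in the modified network. -/
noncomputable def expectedNodeValue : ℝ :=
  ∑ v ∈ Finset.univ \ I.seeds,
    (I.modified.inDegree v : ℝ) / (∑ w ∈ Finset.univ \ I.seeds, (I.modified.inDegree w : ℝ))
      * I.value {v}

/-- Breadth-first search against the direction of the live edges `L`, for a number of levels, from
the frontier `F`, where `R` is the set of nodes visited so far. It returns the visited nodes and the
number of steps: one step for every node that is expanded and one for every edge of the modified
network that points to this node (its coin in `L` is inspected only then, and its tail is marked if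
the edge is live and the tail is new). -/
def reverseSearch (L : Finset (V × V)) : ℕ → Finset V → Finset V → Finset V × ℕ
  | 0, _, R => (R, 0)
  | d + 1, F, R =>
    let new := Finset.univ.filter fun u => u ∉ R ∧ ∃ v ∈ F, (u, v) ∈ L
    let rest := reverseSearch L d new (R ∪ new)
    (rest.1, (∑ v ∈ F, (1 + I.modified.inDegree v)) + rest.2)

/-- Generate a random reverse reachable set of the modified network: draw the root uniformly from
the non-seed nodes (one step) and search backwards from it. -/
noncomputable def sampleRR : Comp (Finset V) :=
  PMF.bind (PMF.uniformOfFinset (Finset.univ \ I.seeds) I.exists_nonseed) fun v =>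
    PMF.bind I.modified.live fun L =>
      Comp.tick 1 (PMF.pure (I.reverseSearch L I.depth {v} {v}))

/-- Add `1 / |R ∩ T|` to the counter of every seed in `R ∩ T`. -/
noncomputable def credit (R : Finset V) (est : V → ℝ) : V → ℝ := fun t =>
  if t ∈ R ∩ I.seeds then est t + 1 / ((R ∩ I.seeds).card : ℝ) else est t

/-- Generate `m` random reverse reachable sets and update the counters, scanning each set once. -/
noncomputable def collect : ℕ → (V → ℝ) → Comp (V → ℝ)
  | 0, est => Comp.ret est
  | m + 1, est =>
    Comp.andThen I.sampleRR fun R => Comp.tick R.card (collect m (I.credit R est))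

/-- The number of seeds with a nonzero counter. Counters are stored sparsely, so that resetting them
takes one step, and selecting the `k`-th largest or writing them out takes one step per nonzero
counter (and one step more). -/
noncomputable def touched (est : V → ℝ) : ℕ := by
  classical exact (I.seeds.filter fun t => est t ≠ 0).card

/-- `x_i = n' / 2 ^ i`. -/
noncomputable def guess (i : ℕ) : ℝ := (I.nonseedCount : ℝ) / 2 ^ i

/-- The total number `θ_i` of sets that phase 1 has generated after its `i`-th round; `θ_0 = 0`. -/
noncomputable def roundTotal (ε l : ℝ) (i : ℕ) : ℕ :=
  if i = 0 then 0 else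
    let ε' := √2 * ε
    ⌈(I.nonseedCount : ℝ) * (2 + 2 / 3 * ε') / (ε' ^ 2 * I.guess i)
      * (l * Real.log I.nonseedCount + Real.log I.seeds.card
        + Real.log (Real.logb 2 I.nonseedCount) + Real.log 2)⌉₊

/-- The rounds of phase 1 from round `i` on, `r` of them at most, with the counters `est`. The result
is the lower bound `LB` for the `k`-th largest Shapley value. -/
noncomputable def thresholdRounds (ε l : ℝ) (k : ℕ) : ℕ → ℕ → (V → ℝ) → Comp ℝ
  | 0, _, _ => Comp.ret 1
  | r + 1, i, est =>
    Comp.andThen (I.collect (I.roundTotal ε l i - I.roundTotal ε l (i - 1)) est) fun est' =>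
      Comp.tick (1 + I.touched est') <| by
        classical exact
          if (I.nonseedCount : ℝ) * (kthLargest I.seeds est' k / I.roundTotal ε l i)
              ≥ (1 + √2 * ε) * I.guess i then
            Comp.ret ((I.nonseedCount : ℝ) * (kthLargest I.seeds est' k
              / (I.roundTotal ε l i * (1 + √2 * ε))))
          else thresholdRounds ε l k r (i + 1) est'

/-- Phase 1: at most `⌊log₂ n'⌋ - 1` rounds. -/
noncomputable def estimateThreshold (ε l : ℝ) (k : ℕ) : Comp ℝ :=
  Comp.tick 1 (I.thresholdRounds ε l k (Nat.log 2 I.nonseedCount - 1) 1 fun _ => 0)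

/-- The number `θ` of sets generated in phase 2, given the lower bound of phase 1. -/
noncomputable def sampleCount (ε l LB : ℝ) : ℕ :=
  ⌈(I.nonseedCount : ℝ) * (2 + 2 / 3 * ε) / (ε ^ 2 * LB)
    * (l * Real.log I.nonseedCount + Real.log I.seeds.card + Real.log 4)⌉₊

/-- The algorithm `ApproxRRset`; its result holds the estimates of the Shapley values of the seeds.
The searches work on the input network and never expand a seed node, so the modified network is not
written out. -/
noncomputable def approxRRset (ε l : ℝ) (k : ℕ) : Comp (V → ℝ) :=
  Comp.andThen (I.estimateThreshold ε l k) fun LB =>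
    Comp.tick 1 <|
      Comp.andThen (I.collect (I.sampleCount ε l LB) fun _ => 0) fun est =>
        Comp.tick (1 + I.touched est) <|
          Comp.ret fun t => (I.nonseedCount : ℝ) * (est t / I.sampleCount ε l LB)

end Attribution

/-! The time is spent on random reverse reachable (RR) sets and on scanning counters, so it is about
the number of sets times the cost of one set. The number of sets is random and depends on the sets
drawn.

Cost of one set. A search expands each visited node at most once, and each visited node except the
root is the tail of an edge into the set. Hence generating and crediting a set costs at most 3(1 +
width), where the width counts the edges of G' into the set. Since v lies in the RR set of w iff the
cascade from v reaches w, exchanging sums shows that the expected width is (m'/n') E[U({ṽ})]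
(`meanWidth_eq`).

What the counters measure. For fixed live edges, U(S) counts the roots whose RR set R meets S
(`value_eq`). In the game "S wins iff S meets R" every seed in R has Shapley value 1/|R ∩ T|, which
is the amount credited. So a set adds Shap(t)/n' to the counter of t in expectation
(`sampleRR_mean_share`).

Number of sets. Let s = Shap^(k), and let j be the first round with x_j (1+ε')² ≤ s; then x_j is
comparable to s (`exists_guess`). A stop in a round i ≤ j leaves LB ≥ x_i ≥ x_j, so phase 2 is cheap
enough, and θ_1, ..., θ_j are bounded by a geometric sequence. Round j is missed with probability at
most 1/n': this is a Chernoff lower tail for k top seeds, a union bound, and the hypothesis on ℓ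
(`missProb_le`). The factor 1/n' pays for the worst case LB = 1 after a miss (`miss_mul_le`). If no
such round exists, s is bounded by a constant and LB = 1 is itself comparable to s.

The dependence between stopping and sampling needs no stopping-time argument: the rounds up to j are
charged in full even if the loop stops earlier, and the miss of round j is judged as if no earlier
round could stop (`thresholdRounds_total_le`). -/

/-! ### Expectations of nonnegative functions -/

namespace PMF

variable {α β : Type*}

/-- The expectation of a nonnegative function. -/
noncomputable def avg (p : PMF α) (f : α → ℝ≥0∞) : ℝ≥0∞ := ∑' a, p a * f a

theorem avg_pure (a : α) (f : α → ℝ≥0∞) : (pure a).avg f = f a := by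
  classical
  unfold avg
  rw [tsum_eq_single a]
  · simp
  · intro b hb
    simp [PMF.pure_apply, hb]

theorem avg_bind (p : PMF α) (g : α → PMF β) (f : β → ℝ≥0∞) :
    (p.bind g).avg f = p.avg fun a => (g a).avg f := by
  unfold avg
  simp_rw [PMF.bind_apply, ← ENNReal.tsum_mul_right, ← ENNReal.tsum_mul_left, mul_assoc]
  exact ENNReal.tsum_comm

theorem avg_map (p : PMF α) (g : α → β) (f : β → ℝ≥0∞) :
    (p.map g).avg f = p.avg fun a => f (g a) := by
  rw [← PMF.bind_pure_comp, avg_bind]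
  simp [avg_pure]

theorem avg_add (p : PMF α) (f g : α → ℝ≥0∞) :
    p.avg (fun a => f a + g a) = p.avg f + p.avg g := by
  simp [avg, mul_add, ENNReal.tsum_add]

theorem avg_mul_left (p : PMF α) (c : ℝ≥0∞) (f : α → ℝ≥0∞) :
    p.avg (fun a => c * f a) = c * p.avg f := by
  simp [avg, ← ENNReal.tsum_mul_left, mul_left_comm]

theorem avg_mul_right (p : PMF α) (c : ℝ≥0∞) (f : α → ℝ≥0∞) :
    p.avg (fun a => f a * c) = p.avg f * c := by
  simp [avg, ← ENNReal.tsum_mul_right, mul_assoc]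

theorem avg_const (p : PMF α) (c : ℝ≥0∞) : p.avg (fun _ => c) = c := by
  simp [avg, ENNReal.tsum_mul_right, p.tsum_coe]

theorem avg_mono (p : PMF α) {f g : α → ℝ≥0∞} (h : ∀ a, f a ≤ g a) : p.avg f ≤ p.avg g :=
  ENNReal.tsum_le_tsum fun a => mul_le_mul_right (h a) _

theorem avg_mono_support (p : PMF α) {f g : α → ℝ≥0∞} (h : ∀ a ∈ p.support, f a ≤ g a) :
    p.avg f ≤ p.avg g :=
  ENNReal.tsum_le_tsum fun a => by
    by_cases ha : a ∈ p.support
    · exact mul_le_mul_right (h a ha) _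
    · simp [(p.apply_eq_zero_iff a).2 ha]

theorem avg_finset_sum {ι : Type*} (p : PMF α) (s : Finset ι) (f : ι → α → ℝ≥0∞) :
    p.avg (fun a => ∑ i ∈ s, f i a) = ∑ i ∈ s, p.avg (f i) := by
  simp only [avg, Finset.mul_sum]
  exact Summable.tsum_finsetSum fun _ _ => ENNReal.summable

theorem avg_eq_sum [Fintype α] (p : PMF α) (f : α → ℝ≥0∞) : p.avg f = ∑ a, p a * f a :=
  tsum_fintype _

end PMF

/-! ### Expected results and expected step counts of computations -/

namespace Comp

variable {α β : Type*}

/-- The expectation of a nonnegative function of the result. -/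
noncomputable def mean (x : Comp α) (φ : α → ℝ≥0∞) : ℝ≥0∞ := PMF.avg x fun r => φ r.1

theorem expectedSteps_eq_avg (x : Comp α) :
    x.expectedSteps = PMF.avg x fun r => (r.2 : ℝ≥0∞) := rfl

theorem mean_ret (a : α) (φ : α → ℝ≥0∞) : (ret a).mean φ = φ a := PMF.avg_pure _ _

theorem mean_tick (c : ℕ) (x : Comp α) (φ : α → ℝ≥0∞) : (tick c x).mean φ = x.mean φ :=
  PMF.avg_map _ _ _

theorem mean_andThen (x : Comp α) (f : α → Comp β) (φ : β → ℝ≥0∞) :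
    (x.andThen f).mean φ = x.mean fun a => (f a).mean φ := by
  unfold mean andThen
  rw [PMF.avg_bind]
  congr 1
  funext r
  exact mean_tick _ _ _

theorem expectedSteps_ret (a : α) : (ret a).expectedSteps = 0 := by
  rw [expectedSteps_eq_avg, ret, PMF.avg_pure, Nat.cast_zero]

theorem expectedSteps_tick (c : ℕ) (x : Comp α) :
    (tick c x).expectedSteps = c + x.expectedSteps := by
  simp only [expectedSteps_eq_avg, tick, PMF.avg_map, Nat.cast_add, PMF.avg_add, PMF.avg_const]

theorem expectedSteps_andThen (x : Comp α) (f : α → Comp β) :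
    (x.andThen f).expectedSteps = x.expectedSteps + x.mean fun a => (f a).expectedSteps := by
  unfold andThen
  rw [expectedSteps_eq_avg, PMF.avg_bind]
  simp only [← expectedSteps_eq_avg, expectedSteps_tick, PMF.avg_add]
  rfl

theorem mean_add (x : Comp α) (φ ψ : α → ℝ≥0∞) :
    x.mean (fun a => φ a + ψ a) = x.mean φ + x.mean ψ := PMF.avg_add _ _ _

theorem mean_mul_left (x : Comp α) (c : ℝ≥0∞) (φ : α → ℝ≥0∞) :
    x.mean (fun a => c * φ a) = c * x.mean φ := PMF.avg_mul_left _ _ _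

theorem mean_mul_right (x : Comp α) (c : ℝ≥0∞) (φ : α → ℝ≥0∞) :
    x.mean (fun a => φ a * c) = x.mean φ * c := PMF.avg_mul_right _ _ _

theorem mean_const (x : Comp α) (c : ℝ≥0∞) : x.mean (fun _ => c) = c := PMF.avg_const _ _

theorem mean_mono (x : Comp α) {φ ψ : α → ℝ≥0∞} (h : ∀ a, φ a ≤ ψ a) :
    x.mean φ ≤ x.mean ψ := PMF.avg_mono _ fun r => h r.1

theorem mean_finset_sum {ι : Type*} (x : Comp α) (s : Finset ι) (φ : ι → α → ℝ≥0∞) :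
    x.mean (fun a => ∑ i ∈ s, φ i a) = ∑ i ∈ s, x.mean (φ i) := PMF.avg_finset_sum _ _ _

/-- The expected number of steps of `x` and of a continuation whose expected cost is `φ`. -/
noncomputable def total (x : Comp α) (φ : α → ℝ≥0∞) : ℝ≥0∞ := x.expectedSteps + x.mean φ

theorem total_ret (a : α) (φ : α → ℝ≥0∞) : (ret a).total φ = φ a := by
  rw [total, expectedSteps_ret, mean_ret, zero_add]

theorem total_tick (c : ℕ) (x : Comp α) (φ : α → ℝ≥0∞) :
    (tick c x).total φ = c + x.total φ := by
  rw [total, expectedSteps_tick, mean_tick, add_assoc, total]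

theorem total_andThen (x : Comp α) (f : α → Comp β) (φ : β → ℝ≥0∞) :
    (x.andThen f).total φ = x.total fun a => (f a).total φ := by
  simp only [total, expectedSteps_andThen, mean_andThen, mean_add, add_assoc]

theorem expectedSteps_andThen_eq_total (x : Comp α) (f : α → Comp β) :
    (x.andThen f).expectedSteps = x.total fun a => (f a).expectedSteps :=
  expectedSteps_andThen x f

end Comp

/-! ### The `k`-th largest value -/

section KthLargest

variable {V : Type*}

theorem card_filter_eq_countP_sort (T : Finset V) (f : V → ℝ) (c : ℝ) :
    (T.filter fun t => c ≤ f t).card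
      = ((T.val.map f).sort (· ≥ ·)).countP (fun y => decide (c ≤ y)) := by
  have h : (((T.val.map f).sort (· ≥ ·) : List ℝ) : Multiset ℝ) = T.val.map f :=
    Multiset.sort_eq _ _
  rw [← Multiset.coe_countP, h, Multiset.countP_map]
  simp [Finset.card, Finset.filter_val]

theorem le_card_filter_kthLargest_le (T : Finset V) (f : V → ℝ) {k : ℕ} (hk : 1 ≤ k)
    (hkT : k ≤ T.card) : k ≤ (T.filter fun t => kthLargest T f k ≤ f t).card := by
  rw [card_filter_eq_countP_sort]
  unfold kthLargest
  set l := (T.val.map f).sort (· ≥ ·) with hl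
  have hlen : l.length = T.card := by simp [hl]
  have hs : l.Pairwise (· ≥ ·) := Multiset.pairwise_sort _ _
  have hidx : k - 1 < l.length := by omega
  rw [List.getD_eq_getElem _ _ hidx]
  have h1 : (l.take k).countP (fun y => decide (l[k - 1] ≤ y)) = (l.take k).length := by
    rw [List.countP_eq_length]
    intro y hy
    obtain ⟨i, hi, rfl⟩ := List.getElem_of_mem hy
    rw [List.length_take] at hi
    rw [List.getElem_take]
    simp only [decide_eq_true_eq]
    rcases Nat.lt_or_ge i (k - 1) with h | h
    · exact List.pairwise_iff_getElem.1 hs i (k - 1) (by omega) hidx h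
    · have : i = k - 1 := by omega
      subst this; exact le_rfl
  calc k = (l.take k).length := by rw [List.length_take]; omega
    _ = _ := h1.symm
    _ ≤ _ := (List.take_sublist k l).countP_le

theorem le_kthLargest (T : Finset V) (f : V → ℝ) {k : ℕ} (hk : 1 ≤ k) {c : ℝ}
    (h : k ≤ (T.filter fun t => c ≤ f t).card) : c ≤ kthLargest T f k := by
  have hkT : k ≤ T.card := h.trans (Finset.card_filter_le _ _)
  rw [card_filter_eq_countP_sort] at h
  unfold kthLargest
  set l := (T.val.map f).sort (· ≥ ·) with hl
  have hlen : l.length = T.card := by simp [hl]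
  have hs : l.Pairwise (· ≥ ·) := Multiset.pairwise_sort _ _
  have hidx : k - 1 < l.length := by omega
  rw [List.getD_eq_getElem _ _ hidx]
  by_contra! hlt
  -- The list decreases, so if the entry with index `k - 1` is below `c`, only the `k - 1` entries
  -- before it can reach `c`.
  have h1 : (l.drop (k - 1)).countP (fun y => decide (c ≤ y)) = 0 := by
    rw [List.countP_eq_zero]
    intro y hy
    obtain ⟨i, hi, rfl⟩ := List.getElem_of_mem hy
    rw [List.length_drop] at hi
    rw [List.getElem_drop]
    simp only [decide_eq_true_eq, not_le]
    refine lt_of_le_of_lt ?_ hlt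
    rcases Nat.eq_zero_or_pos i with h | h
    · subst h; exact le_rfl
    · exact List.pairwise_iff_getElem.1 hs (k - 1) (k - 1 + i) hidx (by omega) (by omega)
  have h2 : l.countP (fun y => decide (c ≤ y)) ≤ k - 1 := by
    conv_lhs => rw [← List.take_append_drop (k - 1) l]
    rw [List.countP_append, h1, add_zero]
    exact List.countP_le_length.trans (List.length_take_le _ _)
  omega

end KthLargest

/-! ### Shapley weights -/

/-- Both sides count the orders of `a` losers and `r + 1` winners, sorted by the number `j` of
losers before the first winner: that winner is chosen in `r + 1` ways, the losers before it in
`a.choose j * j!` ways, and the rest is arbitrary. -/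
theorem sum_choose_mul_factorial_mul_factorial (a r : ℕ) :
    (r + 1) * ∑ j ∈ Finset.range (a + 1), a.choose j * (j.factorial * (a + r - j).factorial)
      = (a + r + 1).factorial := by
  induction a generalizing r with
  | zero => simp [Nat.factorial_succ]
  | succ a ih =>
    rw [Finset.sum_range_succ']
    have h1 : ∀ j ∈ Finset.range (a + 1),
        (a + 1).choose (j + 1) * ((j + 1).factorial * (a + 1 + r - (j + 1)).factorial)
          = (a + 1) * (a.choose j * (j.factorial * (a + r - j).factorial)) := by
      intro j _
      have h2 : (a + 1).choose (j + 1) * (j + 1) = (a + 1) * a.choose j :=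
        (Nat.add_one_mul_choose_eq a j).symm
      have h3 : a + 1 + r - (j + 1) = a + r - j := by omega
      rw [h3, Nat.factorial_succ]
      calc _ = ((a + 1).choose (j + 1) * (j + 1)) * (j.factorial * (a + r - j).factorial) := by ring
        _ = _ := by rw [h2]; ring
    rw [Finset.sum_congr rfl h1, ← Finset.mul_sum, mul_add, mul_left_comm, ih r]
    simp only [Nat.choose_zero_right, Nat.factorial_zero, one_mul, Nat.sub_zero]
    have h4 : a + 1 + r + 1 = (a + r + 1) + 1 := by ring
    have h5 : a + 1 + r = a + r + 1 := by ring
    rw [h4, h5, Nat.factorial_succ (a + r + 1)]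
    ring

/-- A player of a simple majority-of-one game with winning players `R` has Shapley value
`1 / |R|`. -/
theorem sum_shapleyWeight_sdiff {V : Type*} [DecidableEq V] {T R : Finset V} (hR : R ⊆ T)
    (hne : R.Nonempty) :
    ∑ S ∈ (T \ R).powerset,
      ((S.card.factorial * (T.card - S.card - 1).factorial : ℕ) : ℝ) / (T.card.factorial : ℝ)
      = 1 / (R.card : ℝ) := by
  obtain ⟨r, hr⟩ : ∃ r, R.card = r + 1 := ⟨R.card - 1, by have := hne.card_pos; omega⟩
  have hT : T.card = (T \ R).card + r + 1 := by
    have := Finset.card_sdiff_add_card_eq_card hR; omega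
  set a := (T \ R).card with ha
  rw [← Finset.sum_div, ← Nat.cast_sum, Finset.sum_powerset_apply_card
    (fun j => j.factorial * (T.card - j - 1).factorial)]
  have h := sum_choose_mul_factorial_mul_factorial a r
  rw [← ha, hT, hr, ← h]
  have h1 : ∑ m ∈ Finset.range (a + 1),
      a.choose m • (m.factorial * (a + r + 1 - m - 1).factorial)
      = ∑ j ∈ Finset.range (a + 1), a.choose j * (j.factorial * (a + r - j).factorial) := by
    refine Finset.sum_congr rfl fun j _ => ?_
    rw [show a + r + 1 - j - 1 = a + r - j by omega, smul_eq_mul]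
  rw [h1]
  have hpos : 0 < ∑ j ∈ Finset.range (a + 1),
      a.choose j * (j.factorial * (a + r - j).factorial) := by
    have := Nat.factorial_pos (a + r + 1)
    rw [← h] at this
    exact Nat.pos_of_mul_pos_left this
  have : (0 : ℝ) < ((∑ j ∈ Finset.range (a + 1),
      a.choose j * (j.factorial * (a + r - j).factorial) : ℕ) : ℝ) := by exact_mod_cast hpos
  rw [Nat.cast_mul]
  field_simp

/-! ### Reachability along live edges -/

namespace Network

section Within

variable {V : Type*}

/-- `v` can be reached from `u` along at most `d` edges of `L`. -/
def Within (L : Finset (V × V)) : ℕ → V → V → Prop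
  | 0, u, v => u = v
  | d + 1, u, v => u = v ∨ ∃ w, (u, w) ∈ L ∧ Within L d w v

theorem Within.refl (L : Finset (V × V)) (d : ℕ) (v : V) : Within L d v v := by
  cases d with
  | zero => rfl
  | succ d => exact Or.inl rfl

theorem Within.succ {L : Finset (V × V)} {d : ℕ} {u v : V} (h : Within L d u v) :
    Within L (d + 1) u v := by
  induction d generalizing u with
  | zero => exact Or.inl h
  | succ d ih =>
    rcases h with h | ⟨w, hw, h⟩
    · exact Or.inl h
    · exact Or.inr ⟨w, hw, ih h⟩

/-- `Within` splits off the first edge of a path, while a cascade appends the last one; this passes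
from one to the other. -/
theorem within_succ_iff {L : Finset (V × V)} {d : ℕ} {u v : V} :
    Within L (d + 1) u v ↔ Within L d u v ∨ ∃ w, Within L d u w ∧ (w, v) ∈ L := by
  constructor
  · induction d generalizing u with
    | zero =>
      rintro (h | ⟨w, hw, h⟩)
      · exact Or.inl h
      · exact Or.inr ⟨u, rfl, (show w = v from h) ▸ hw⟩
    | succ d ih =>
      rintro (h | ⟨w, hw, h⟩)
      · exact Or.inl (h ▸ Within.refl _ _ _)
      · rcases ih h with h | ⟨x, hx, hxv⟩
        · exact Or.inl (Or.inr ⟨w, hw, h⟩)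
        · exact Or.inr ⟨x, Or.inr ⟨w, hw, hx⟩, hxv⟩
  · rintro (h | ⟨w, h, hw⟩)
    · exact h.succ
    · induction d generalizing u with
      | zero => exact Or.inr ⟨v, (show u = w from h) ▸ hw, rfl⟩
      | succ d ih =>
        rcases h with h | ⟨x, hx, h⟩
        · exact Or.inr ⟨v, h ▸ hw, Within.refl _ _ _⟩
        · exact Or.inr ⟨x, hx, ih h⟩

theorem within_image_swap [DecidableEq V] {L : Finset (V × V)} {d : ℕ} {u v : V} :
    Within (L.image Prod.swap) d v u ↔ Within L d u v := by
  induction d generalizing v with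
  | zero => exact eq_comm
  | succ d ih =>
    have hsw : ∀ a b : V, (a, b) ∈ L.image Prod.swap ↔ (b, a) ∈ L := by
      intro a b
      simp [Prod.swap, Prod.ext_iff, and_comm]
    conv_rhs => rw [within_succ_iff]
    show (v = u ∨ ∃ w, (v, w) ∈ L.image Prod.swap ∧ Within (L.image Prod.swap) d w u) ↔ _
    simp only [ih, hsw]
    constructor
    · rintro (h | ⟨w, hw, h⟩)
      · exact Or.inl (h ▸ Within.refl _ _ _)
      · exact Or.inr ⟨w, h, hw⟩
    · rintro (h | ⟨w, h, hw⟩)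
      · rcases (ih.2 h).succ with h | ⟨w, hw, h⟩
        · exact Or.inl h
        · exact Or.inr ⟨w, (hsw _ _).1 hw, ih.1 h⟩
      · exact Or.inr ⟨w, hw, h⟩

/-- Removing the nodes of `T \ S` does not change what `S` reaches outside `T`, compared with
removing the edges into `T`. -/
theorem exists_within_filter_iff [DecidableEq V] (L : Finset (V × V)) (T S : Finset V) (d : ℕ)
    {v : V} :
    (∃ u ∈ S, Within (L.filter fun e => e.1 ∉ T \ S ∧ e.2 ∉ T \ S) d u v) ↔
      ∃ u ∈ S, Within (L.filter fun e => e.2 ∉ T) d u v := by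
  constructor
  · rintro ⟨u, hu, h⟩
    have key : ∀ d u, Within (L.filter fun e => e.1 ∉ T \ S ∧ e.2 ∉ T \ S) d u v →
        Within (L.filter fun e => e.2 ∉ T) d u v ∨
          ∃ u ∈ S, Within (L.filter fun e => e.2 ∉ T) d u v := by
      intro d
      induction d with
      | zero => exact fun u h => Or.inl h
      | succ d ih =>
        rintro u (h | ⟨w, hw, h⟩)
        · exact Or.inl (h ▸ Within.refl _ _ _)
        · rcases ih w h with h | ⟨x, hx, h⟩
          · by_cases hwT : w ∈ T
            · refine Or.inr ⟨w, ?_, h.succ⟩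
              have := (Finset.mem_filter.1 hw).2.2
              by_contra hwS
              exact this (Finset.mem_sdiff.2 ⟨hwT, hwS⟩)
            · exact Or.inl (Or.inr ⟨w, Finset.mem_filter.2 ⟨(Finset.mem_filter.1 hw).1, hwT⟩, h⟩)
          · exact Or.inr ⟨x, hx, h.succ⟩
    rcases key d u h with h | h
    · exact ⟨u, hu, h⟩
    · exact h
  · rintro ⟨u, hu, h⟩
    have key : ∀ d u, u ∉ T \ S → Within (L.filter fun e => e.2 ∉ T) d u v →
        Within (L.filter fun e => e.1 ∉ T \ S ∧ e.2 ∉ T \ S) d u v := by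
      intro d
      induction d with
      | zero => exact fun u _ h => h
      | succ d ih =>
        rintro u hu (h | ⟨w, hw, h⟩)
        · exact h ▸ Within.refl _ _ _
        · obtain ⟨hwL, hwT⟩ := Finset.mem_filter.1 hw
          have hw' : w ∉ T \ S := fun h => hwT (Finset.mem_sdiff.1 h).1
          exact Or.inr ⟨w, Finset.mem_filter.2 ⟨hwL, hu, hw'⟩, ih w hw' h⟩
    exact ⟨u, hu, key d u (fun h => (Finset.mem_sdiff.1 h).2 hu) h⟩

end Within

variable {V : Type*} [Fintype V] [DecidableEq V]

theorem cascade_snd_subset (L : Finset (V × V)) (S : Finset V) (d : ℕ) :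
    (cascade L S d).2 ⊆ (cascade L S d).1 := by
  cases d with
  | zero => exact subset_rfl
  | succ d => exact Finset.subset_union_right

/-- An active node that is not new made its attempts in an earlier step. Hence restricting the
attempts to new nodes loses nothing against plain reachability. -/
theorem mem_cascade_of_edge (L : Finset (V × V)) (S : Finset V) (d : ℕ) {u v : V}
    (hu : u ∈ (cascade L S d).1) (hu' : u ∉ (cascade L S d).2) (h : (u, v) ∈ L) :
    v ∈ (cascade L S d).1 := by
  induction d with
  | zero => exact absurd hu hu'
  | succ d ih =>
    simp only [cascade, Finset.mem_union, Finset.mem_filter, Finset.mem_univ, true_and] at *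
    by_cases hv : v ∈ (cascade L S d).1
    · exact Or.inl hv
    · by_cases hu2 : u ∈ (cascade L S d).2
      · exact Or.inr ⟨hv, u, hu2, h⟩
      · rcases hu with hu | hu
        · exact absurd (ih hu hu2) hv
        · exact absurd hu hu'

theorem mem_cascade (L : Finset (V × V)) (S : Finset V) (d : ℕ) (v : V) :
    v ∈ (cascade L S d).1 ↔ ∃ u ∈ S, Within L d u v := by
  induction d generalizing v with
  | zero => simp [cascade, Within]
  | succ d ih =>
    have h1 : v ∈ (cascade L S (d + 1)).1 ↔
        v ∈ (cascade L S d).1 ∨ ∃ u ∈ (cascade L S d).1, (u, v) ∈ L := by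
      simp only [cascade, Finset.mem_union, Finset.mem_filter, Finset.mem_univ, true_and]
      constructor
      · rintro (h | ⟨-, u, hu, h⟩)
        · exact Or.inl h
        · exact Or.inr ⟨u, cascade_snd_subset L S d hu, h⟩
      · rintro (h | ⟨u, hu, h⟩)
        · exact Or.inl h
        · by_cases hv : v ∈ (cascade L S d).1
          · exact Or.inl hv
          · refine Or.inr ⟨hv, u, ?_, h⟩
            by_contra hu2
            exact hv (mem_cascade_of_edge L S d hu hu2 h)
    rw [h1, ih]
    simp only [ih, within_succ_iff]
    constructor
    · rintro (⟨u, hu, h⟩ | ⟨w, ⟨u, hu, h⟩, hw⟩)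
      · exact ⟨u, hu, Or.inl h⟩
      · exact ⟨u, hu, Or.inr ⟨w, h, hw⟩⟩
    · rintro ⟨u, hu, h | ⟨w, h, hw⟩⟩
      · exact Or.inl ⟨u, hu, h⟩
      · exact Or.inr ⟨w, ⟨u, hu, h⟩, hw⟩

/-! ### Marginals of the live-edge graph -/

theorem live_avg (G : Network V) (f : Finset (V × V) → ℝ≥0∞) :
    G.live.avg f = ∑ L ∈ G.edges.powerset,
      (∏ e ∈ L, (G.prob e : ℝ≥0∞)) * (∏ e ∈ G.edges \ L, (1 - (G.prob e : ℝ≥0∞))) * f L := by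
  rw [PMF.avg_eq_sum, ← Finset.sum_subset (Finset.subset_univ G.edges.powerset)]
  · refine Finset.sum_congr rfl fun L hL => ?_
    rw [live_apply, liveWeight, if_pos hL]
  · intro L _ hL
    rw [live_apply, G.liveWeight_eq_zero L hL, zero_mul]

/-- The coins of the dropped edges are independent of the others and their weights sum to 1. This
puts all subnetworks on the one probability space `G.live`, where they can be compared for the same
live edges. -/
theorem live_keep_avg (G : Network V) (P : V × V → Prop) [DecidablePred P]
    (f : Finset (V × V) → ℝ≥0∞) :
    (G.keep P).live.avg f = G.live.avg fun L => f (L.filter P) := by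
  rw [live_avg, live_avg]
  set w : Finset (V × V) → Finset (V × V) → ℝ≥0∞ := fun E L =>
    (∏ e ∈ L, (G.prob e : ℝ≥0∞)) * ∏ e ∈ E \ L, (1 - (G.prob e : ℝ≥0∞)) with hw
  have hone : ∑ B ∈ (G.edges.filter fun e => ¬ P e).powerset,
      w (G.edges.filter fun e => ¬ P e) B = 1 := by
    rw [hw, ← Finset.prod_add]
    refine Finset.prod_eq_one fun e he => ?_
    exact add_tsub_cancel_of_le
      (by exact_mod_cast G.prob_le_one e (Finset.mem_filter.mp he).1)
  have h1 : ∑ A ∈ (G.edges.filter P).powerset, w (G.edges.filter P) A * f A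
      = ∑ x ∈ (G.edges.filter P).powerset ×ˢ (G.edges.filter fun e => ¬ P e).powerset,
        w (G.edges.filter P) x.1 * f x.1 * w (G.edges.filter fun e => ¬ P e) x.2 := by
    rw [Finset.sum_product]
    refine Finset.sum_congr rfl fun A _ => ?_
    dsimp only
    rw [← Finset.mul_sum, hone, mul_one]
  refine h1.trans ?_
  refine Finset.sum_nbij' (fun x => x.1 ∪ x.2)
    (fun L => (L.filter P, L.filter fun e => ¬ P e)) ?_ ?_ ?_ ?_ ?_
  · rintro ⟨A, B⟩ h
    simp only [Finset.mem_product, Finset.mem_powerset] at h ⊢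
    exact Finset.union_subset (h.1.trans (Finset.filter_subset _ _))
      (h.2.trans (Finset.filter_subset _ _))
  · intro L hL
    simp only [Finset.mem_product, Finset.mem_powerset] at hL ⊢
    exact ⟨Finset.filter_subset_filter _ hL, Finset.filter_subset_filter _ hL⟩
  · rintro ⟨A, B⟩ h
    simp only [Finset.mem_product, Finset.mem_powerset] at h
    ext e
    · simp only [Finset.mem_filter, Finset.mem_union]
      constructor
      · rintro ⟨h' | h', hP⟩
        · exact h'
        · exact absurd hP (Finset.mem_filter.1 (h.2 h')).2
      · exact fun h' => ⟨Or.inl h', (Finset.mem_filter.1 (h.1 h')).2⟩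
    · simp only [Finset.mem_filter, Finset.mem_union]
      constructor
      · rintro ⟨h' | h', hP⟩
        · exact absurd (Finset.mem_filter.1 (h.1 h')).2 hP
        · exact h'
      · exact fun h' => ⟨Or.inr h', (Finset.mem_filter.1 (h.2 h')).2⟩
  · intro L _
    exact Finset.filter_union_filter_not_eq _ _
  · rintro ⟨A, B⟩ h
    simp only [Finset.mem_product, Finset.mem_powerset] at h
    have hA : ∀ e ∈ A, e ∈ G.edges ∧ P e := fun e he => Finset.mem_filter.1 (h.1 he)
    have hB : ∀ e ∈ B, e ∈ G.edges ∧ ¬ P e := fun e he => Finset.mem_filter.1 (h.2 he)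
    have hdisj : Disjoint A B := Finset.disjoint_left.2 fun e h1 h2 => (hB e h2).2 (hA e h1).2
    have hsd : G.edges \ (A ∪ B)
        = (G.edges.filter P \ A) ∪ ((G.edges.filter fun e => ¬ P e) \ B) := by
      ext e
      simp only [Finset.mem_sdiff, Finset.mem_union, Finset.mem_filter]
      constructor
      · intro h'
        by_cases hP : P e
        · exact Or.inl ⟨⟨h'.1, hP⟩, fun h2 => h'.2 (Or.inl h2)⟩
        · exact Or.inr ⟨⟨h'.1, hP⟩, fun h2 => h'.2 (Or.inr h2)⟩
      · rintro (⟨⟨h1, h2⟩, h3⟩ | ⟨⟨h1, h2⟩, h3⟩)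
        · exact ⟨h1, fun h4 => h4.elim h3 fun h5 => (hB e h5).2 h2⟩
        · exact ⟨h1, fun h4 => h4.elim (fun h5 => h2 (hA e h5).2) h3⟩
    have hdisj2 : Disjoint (G.edges.filter P \ A) ((G.edges.filter fun e => ¬ P e) \ B) :=
      (Finset.disjoint_filter_filter_not _ _ _).mono Finset.sdiff_subset Finset.sdiff_subset
    have hfilt : (A ∪ B).filter P = A := by
      ext e
      simp only [Finset.mem_filter, Finset.mem_union]
      constructor
      · rintro ⟨h' | h', hP⟩
        · exact h'
        · exact absurd hP (hB e h').2
      · exact fun h' => ⟨Or.inl h', (hA e h').2⟩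
    dsimp only
    rw [hfilt, hsd, Finset.prod_union hdisj, Finset.prod_union hdisj2, hw]
    dsimp only
    ring

end Network

namespace PMF

theorem toReal_avg_ofReal {α : Type*} [Fintype α] (p : PMF α) {f : α → ℝ} (hf : ∀ a, 0 ≤ f a) :
    (p.avg fun a => ENNReal.ofReal (f a)).toReal = ∑ a, (p a).toReal * f a := by
  rw [avg_eq_sum, ENNReal.toReal_sum fun a _ =>
    ENNReal.mul_ne_top (p.apply_ne_top a) ENNReal.ofReal_ne_top]
  refine Finset.sum_congr rfl fun a _ => ?_
  rw [ENNReal.toReal_mul, ENNReal.toReal_ofReal (hf a)]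

theorem avg_ofReal {α : Type*} [Fintype α] (p : PMF α) {f : α → ℝ} (hf : ∀ a, 0 ≤ f a) :
    (p.avg fun a => ENNReal.ofReal (f a)) = ENNReal.ofReal (∑ a, (p a).toReal * f a) := by
  rw [← toReal_avg_ofReal p hf, ENNReal.ofReal_toReal]
  rw [avg_eq_sum]
  exact ENNReal.sum_ne_top.2 fun a _ =>
    ENNReal.mul_ne_top (p.apply_ne_top a) ENNReal.ofReal_ne_top

end PMF

/-! ### Reverse reachable sets and Shapley values -/

namespace Attribution

open Network

variable {V : Type*} [Fintype V] [DecidableEq V] (I : Attribution V)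

/-- A backward search is the cascade in the reversed live-edge graph. The search may start from the
state after any `τ` steps, because the induction moves the frontier. -/
theorem fst_reverseSearch_cascade (L : Finset (V × V)) (S : Finset V) (d τ : ℕ) :
    (I.reverseSearch L d (cascade (L.image Prod.swap) S τ).2
      (cascade (L.image Prod.swap) S τ).1).1 = (cascade (L.image Prod.swap) S (τ + d)).1 := by
  induction d generalizing τ with
  | zero => rfl
  | succ d ih =>
    have h := ih (τ + 1)
    rw [show τ + 1 + d = τ + (d + 1) by ring] at h
    rw [← h]
    simp [reverseSearch, cascade, Prod.swap, Prod.ext_iff, and_comm]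

theorem mem_reverseSearch (L : Finset (V × V)) (d : ℕ) (u v : V) :
    u ∈ (I.reverseSearch L d {v} {v}).1 ↔ Within L d u v := by
  have h := I.fst_reverseSearch_cascade L {v} d 0
  rw [show cascade (L.image Prod.swap) {v} 0 = ({v}, {v}) from rfl] at h
  rw [h, mem_cascade]
  simp [within_image_swap]

/-- The reverse reachable set of the node `v` in the modified network, for the live edges `L` of
the input network. -/
def reverseSet (L : Finset (V × V)) (v : V) : Finset V :=
  (I.reverseSearch (L.filter fun e => e.2 ∉ I.seeds) I.depth {v} {v}).1

/-- A non-seed node becomes active from `S` iff its reverse reachable set meets `S`. The graph that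
depends on `S` is replaced by the one modified graph, so all values `U(S)` are coupled through the
same live edges. -/
theorem value_eq (S : Finset V) :
    I.value S = ∑ L, (I.net.live L).toReal
      * ∑ v ∈ Finset.univ \ I.seeds, if (I.reverseSet L v ∩ S).Nonempty then (1 : ℝ) else 0 := by
  unfold value Network.value
  set H := I.net.keep fun e => e.1 ∉ I.seeds \ S ∧ e.2 ∉ I.seeds \ S with hH
  have h1 : ∑ L ∈ H.edges.powerset, (H.live L).toReal
        * ((((cascade L S I.depth).1 \ I.seeds).card : ℕ) : ℝ)
      = ∑ L, (H.live L).toReal * ((((cascade L S I.depth).1 \ I.seeds).card : ℕ) : ℝ) := by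
    refine Finset.sum_subset (Finset.subset_univ _) fun L _ hL => ?_
    rw [live_apply, H.liveWeight_eq_zero L hL, ENNReal.toReal_zero, zero_mul]
  refine h1.trans ?_
  rw [← PMF.toReal_avg_ofReal _ fun _ => Nat.cast_nonneg _, hH, live_keep_avg,
    PMF.toReal_avg_ofReal _ fun _ => Nat.cast_nonneg _]
  refine Finset.sum_congr rfl fun L _ => ?_
  rw [Finset.sum_boole]
  congr 3
  ext v
  rw [Finset.mem_sdiff, Finset.mem_filter, Finset.mem_sdiff, mem_cascade, and_comm]
  simp only [Finset.mem_univ, true_and]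
  refine and_congr_right fun _ => ?_
  rw [exists_within_filter_iff L I.seeds S I.depth]
  simp only [Finset.Nonempty, Finset.mem_inter, reverseSet, mem_reverseSearch]
  exact exists_congr fun u => and_comm

/-- The amount that the reverse reachable set `R` adds to the counter of `t`. -/
noncomputable def share (t : V) (R : Finset V) : ℝ :=
  if t ∈ R ∩ I.seeds then 1 / ((R ∩ I.seeds).card : ℝ) else 0

theorem share_nonneg (t : V) (R : Finset V) : 0 ≤ I.share t R := by
  unfold share; split_ifs <;> positivity

theorem share_le_one (t : V) (R : Finset V) : I.share t R ≤ 1 := by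
  unfold share
  split_ifs with h
  · have h1 : (1 : ℝ) ≤ ((R ∩ I.seeds).card : ℝ) := by
      exact_mod_cast Finset.card_pos.2 ⟨t, h⟩
    exact (div_le_one (by linarith)).2 h1
  · exact zero_le_one

theorem credit_eq (R : Finset V) (est : V → ℝ) (t : V) :
    I.credit R est t = est t + I.share t R := by
  unfold credit share; split_ifs <;> simp

/-- Joining `t` turns `S` from losing to winning exactly when `t ∈ R` and `S` avoids `R`. So only
the subsets of `T \ R` contribute, and their weights sum to `1 / |R ∩ T|`. -/
theorem sum_shapleyWeight_eq_share {t : V} (ht : t ∈ I.seeds) (R : Finset V) :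
    ∑ S ∈ (I.seeds.erase t).powerset,
      ((S.card.factorial * (I.seeds.card - S.card - 1).factorial : ℕ) : ℝ)
        / (I.seeds.card.factorial : ℝ)
        * ((if (R ∩ insert t S).Nonempty then (1 : ℝ) else 0)
          - if (R ∩ S).Nonempty then (1 : ℝ) else 0) = I.share t R := by
  unfold share
  by_cases htR : t ∈ R
  · have hmem : t ∈ R ∩ I.seeds := Finset.mem_inter.2 ⟨htR, ht⟩
    rw [if_pos hmem, ← sum_shapleyWeight_sdiff Finset.inter_subset_right ⟨t, hmem⟩]
    symm
    have hsub : (I.seeds \ (R ∩ I.seeds)).powerset ⊆ (I.seeds.erase t).powerset := by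
      refine Finset.powerset_mono.2 fun x hx => ?_
      obtain ⟨h1, h2⟩ := Finset.mem_sdiff.1 hx
      exact Finset.mem_erase.2 ⟨fun h => h2 (h ▸ hmem), h1⟩
    rw [← Finset.sum_subset hsub]
    · refine Finset.sum_congr rfl fun S hS => ?_
      have h1 : (R ∩ insert t S).Nonempty :=
        ⟨t, Finset.mem_inter.2 ⟨htR, Finset.mem_insert_self _ _⟩⟩
      have h2 : ¬ (R ∩ S).Nonempty := by
        rintro ⟨x, hx⟩
        obtain ⟨h3, h4⟩ := Finset.mem_inter.1 hx
        obtain ⟨h5, h6⟩ := Finset.mem_sdiff.1 (Finset.mem_powerset.1 hS h4)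
        exact h6 (Finset.mem_inter.2 ⟨h3, h5⟩)
      rw [if_pos h1, if_neg h2, sub_zero, mul_one]
    · intro S hS hS'
      have h1 : (R ∩ insert t S).Nonempty :=
        ⟨t, Finset.mem_inter.2 ⟨htR, Finset.mem_insert_self _ _⟩⟩
      have h2 : (R ∩ S).Nonempty := by
        by_contra h3
        refine hS' (Finset.mem_powerset.2 fun x hx => Finset.mem_sdiff.2
          ⟨Finset.mem_of_mem_erase (Finset.mem_powerset.1 hS hx), fun h4 => h3 ⟨x, ?_⟩⟩)
        exact Finset.mem_inter.2 ⟨(Finset.mem_inter.1 h4).1, hx⟩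
      rw [if_pos h1, if_pos h2, sub_self, mul_zero]
  · rw [if_neg fun h => htR (Finset.mem_inter.1 h).1]
    refine Finset.sum_eq_zero fun S _ => ?_
    rw [Finset.inter_insert_of_notMem htR, sub_self, mul_zero]

theorem shapley_eq {t : V} (ht : t ∈ I.seeds) :
    I.net.shapley I.seeds I.depth t = ∑ L, (I.net.live L).toReal
      * ∑ v ∈ Finset.univ \ I.seeds, I.share t (I.reverseSet L v) := by
  unfold Network.shapley
  have h : ∀ S, I.net.value I.seeds I.depth S = _ := I.value_eq
  simp only [h, ← Finset.sum_sub_distrib, ← mul_sub, ← I.sum_shapleyWeight_eq_share ht]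
  simp only [Finset.mul_sum]
  rw [Finset.sum_comm]
  refine Finset.sum_congr rfl fun L _ => ?_
  rw [Finset.sum_comm]
  refine Finset.sum_congr rfl fun v _ => Finset.sum_congr rfl fun S _ => ?_
  ring

theorem sampleRR_avg (g : Finset V × ℕ → ℝ≥0∞) :
    PMF.avg I.sampleRR g = I.modified.live.avg fun L => ∑ v ∈ Finset.univ \ I.seeds,
      (I.nonseedCount : ℝ≥0∞)⁻¹ * g ((I.reverseSearch L I.depth {v} {v}).1,
        1 + (I.reverseSearch L I.depth {v} {v}).2) := by
  unfold sampleRR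
  simp only [PMF.avg_bind, Comp.tick, PMF.avg_map, PMF.avg_pure, PMF.avg_finset_sum,
    PMF.avg_mul_left]
  rw [PMF.avg_eq_sum, ← Finset.sum_subset (Finset.subset_univ (Finset.univ \ I.seeds))]
  · refine Finset.sum_congr rfl fun v hv => ?_
    rw [PMF.uniformOfFinset_apply_of_mem _ hv]
    rfl
  · intro v _ hv
    rw [PMF.uniformOfFinset_apply_of_notMem _ hv, zero_mul]

theorem sampleRR_mean (g : Finset V → ℝ≥0∞) :
    I.sampleRR.mean g = I.net.live.avg fun L => ∑ v ∈ Finset.univ \ I.seeds,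
      (I.nonseedCount : ℝ≥0∞)⁻¹ * g (I.reverseSet L v) := by
  unfold Comp.mean
  rw [sampleRR_avg, modified, live_keep_avg]
  rfl

theorem nonseedCount_pos : 0 < I.nonseedCount := Finset.card_pos.2 I.exists_nonseed

theorem sampleRR_mean_ofReal {g : Finset V → ℝ} (hg : ∀ R, 0 ≤ g R) :
    I.sampleRR.mean (fun R => ENNReal.ofReal (g R)) = ENNReal.ofReal
      ((∑ L, (I.net.live L).toReal * ∑ v ∈ Finset.univ \ I.seeds, g (I.reverseSet L v))
        / I.nonseedCount) := by
  have hN : (0 : ℝ) < I.nonseedCount := by exact_mod_cast I.nonseedCount_pos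
  rw [sampleRR_mean]
  simp only [← Finset.mul_sum]
  rw [PMF.avg_mul_left]
  simp only [← ENNReal.ofReal_sum_of_nonneg fun v _ => hg _]
  rw [PMF.avg_ofReal _ fun L => Finset.sum_nonneg fun v _ => hg _, div_eq_inv_mul,
    ENNReal.ofReal_mul (by positivity), ENNReal.ofReal_inv_of_pos hN, ENNReal.ofReal_natCast]

theorem sampleRR_mean_share {t : V} (ht : t ∈ I.seeds) :
    I.sampleRR.mean (fun R => ENNReal.ofReal (I.share t R))
      = ENNReal.ofReal (I.net.shapley I.seeds I.depth t / I.nonseedCount) := by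
  rw [I.sampleRR_mean_ofReal (I.share_nonneg t), I.shapley_eq ht]

theorem shapley_nonneg {t : V} (ht : t ∈ I.seeds) : 0 ≤ I.net.shapley I.seeds I.depth t := by
  rw [I.shapley_eq ht]
  exact Finset.sum_nonneg fun L _ => mul_nonneg ENNReal.toReal_nonneg
    (Finset.sum_nonneg fun v _ => I.share_nonneg _ _)

theorem sum_toReal_live (G : Network V) : ∑ L, (G.live L).toReal = 1 := by
  have h := PMF.toReal_avg_ofReal G.live (f := fun _ => 1) fun _ => zero_le_one
  simpa [PMF.avg_const] using h.symm

theorem shapley_le {t : V} (ht : t ∈ I.seeds) :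
    I.net.shapley I.seeds I.depth t ≤ I.nonseedCount := by
  rw [I.shapley_eq ht]
  calc _ ≤ ∑ L, (I.net.live L).toReal * (I.nonseedCount : ℝ) := by
        refine Finset.sum_le_sum fun L _ => mul_le_mul_of_nonneg_left ?_ ENNReal.toReal_nonneg
        calc _ ≤ ∑ v ∈ Finset.univ \ I.seeds, (1 : ℝ) :=
              Finset.sum_le_sum fun v _ => I.share_le_one _ _
          _ = _ := by rw [Finset.sum_const, nsmul_eq_mul, mul_one]; rfl
    _ = _ := by rw [← Finset.sum_mul, sum_toReal_live, one_mul]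

theorem shapleyKth_le {k : ℕ} (hk : 1 ≤ k) (hkT : k ≤ I.seeds.card) :
    I.shapleyKth k ≤ I.nonseedCount := by
  have h := le_card_filter_kthLargest_le I.seeds (I.net.shapley I.seeds I.depth) hk hkT
  obtain ⟨t, ht⟩ := Finset.card_pos.1 (lt_of_lt_of_le hk h)
  obtain ⟨h1, h2⟩ := Finset.mem_filter.1 ht
  exact h2.trans (I.shapley_le h1)

/-! ### The cost of a reverse search -/

/-- The number of edges of the modified network that point into `R`. -/
def width (R : Finset V) : ℕ := ∑ v ∈ R, I.modified.inDegree v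

theorem subset_reverseSearch (L : Finset (V × V)) (d : ℕ) (F R : Finset V) :
    R ⊆ (I.reverseSearch L d F R).1 := by
  induction d generalizing F R with
  | zero => exact subset_rfl
  | succ d ih => exact Finset.subset_union_left.trans (ih _ _)

/-- The nodes of `R \ F` were paid for at earlier levels, and each later node enters a frontier
once. There is no equality, because the last frontier is not expanded. -/
theorem reverseSearch_steps_le (L : Finset (V × V)) (d : ℕ) {F R : Finset V} (hF : F ⊆ R) :
    (I.reverseSearch L d F R).2
      ≤ ∑ v ∈ (I.reverseSearch L d F R).1 \ (R \ F), (1 + I.modified.inDegree v) := by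
  induction d generalizing F R with
  | zero => exact Nat.zero_le _
  | succ d ih =>
    set new := Finset.univ.filter fun u => u ∉ R ∧ ∃ v ∈ F, (u, v) ∈ L with hnew
    have h1 := ih (F := new) (R := R ∪ new) Finset.subset_union_right
    have hdisj : Disjoint R new :=
      Finset.disjoint_left.2 fun x hx hx' => (Finset.mem_filter.1 hx').2.1 hx
    rw [Finset.union_sdiff_cancel_right hdisj] at h1
    set Q := (I.reverseSearch L d new (R ∪ new)).1 with hQ
    have hRQ : R ⊆ Q := Finset.subset_union_left.trans (I.subset_reverseSearch _ _ _ _)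
    have h2 : (I.reverseSearch L (d + 1) F R).1 = Q := rfl
    have h3 : (I.reverseSearch L (d + 1) F R).2 = (∑ v ∈ F, (1 + I.modified.inDegree v))
      + (I.reverseSearch L d new (R ∪ new)).2 := rfl
    have h4 : Q \ (R \ F) = F ∪ (Q \ R) := by
      ext x
      simp only [Finset.mem_sdiff, Finset.mem_union]
      have := @hF x
      have := @hRQ x
      tauto
    have h5 : Disjoint F (Q \ R) :=
      Finset.disjoint_left.2 fun x hx hx' => (Finset.mem_sdiff.1 hx').2 (hF hx)
    rw [h2, h3, h4, Finset.sum_union h5]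
    exact Nat.add_le_add_left h1 _

/-- The first edge of a live path from a visited node to the root has a visited head. So every
visited node but the root is the tail of an edge into the set, and the width controls the number of
nodes as well. -/
theorem card_reverseSearch_le {L : Finset (V × V)} (hL : L ⊆ I.modified.edges) (d : ℕ) (v : V) :
    (I.reverseSearch L d {v} {v}).1.card ≤ 1 + I.width (I.reverseSearch L d {v} {v}).1 := by
  set R := (I.reverseSearch L d {v} {v}).1 with hR
  have h1 : R ⊆ insert v ((I.modified.edges.filter fun e => e.2 ∈ R).image Prod.fst) := by
    intro u hu
    rw [hR, mem_reverseSearch] at hu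
    rcases d with _ | d
    · exact Finset.mem_insert.2 (Or.inl hu)
    · rcases hu with hu | ⟨w, hw, h⟩
      · exact Finset.mem_insert.2 (Or.inl hu)
      · refine Finset.mem_insert_of_mem (Finset.mem_image.2 ⟨(u, w), ?_, rfl⟩)
        refine Finset.mem_filter.2 ⟨hL hw, ?_⟩
        rw [hR, mem_reverseSearch]
        exact h.succ
  have h2 : (I.modified.edges.filter fun e => e.2 ∈ R).card = I.width R := by
    rw [Finset.card_eq_sum_card_fiberwise (f := Prod.snd) (t := R)]
    · refine Finset.sum_congr rfl fun x hx => ?_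
      rw [Network.inDegree, Finset.filter_filter]
      congr 1
      ext e
      simp only [Finset.mem_filter]
      constructor
      · exact fun h => ⟨h.1, h.2.2⟩
      · exact fun h => ⟨h.1, h.2 ▸ hx, h.2⟩
    · intro e he
      exact (Finset.mem_filter.1 he).2
  calc R.card ≤ _ := Finset.card_le_card h1
    _ ≤ _ := Finset.card_insert_le _ _
    _ ≤ _ := by rw [add_comm]; exact Nat.add_le_add_left (Finset.card_image_le.trans h2.le) _

/-- The expected number of edges of the modified network into a random reverse reachable set. -/
noncomputable def meanWidth : ℝ≥0∞ := I.sampleRR.mean fun R => (I.width R : ℝ≥0∞)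

/-- A bound for the expected cost of generating, crediting and scanning one random set. -/
noncomputable def unitCost : ℝ≥0∞ := 3 * (1 + I.meanWidth)

theorem subset_of_mem_support_live (G : Network V) {L : Finset (V × V)} (h : L ∈ G.live.support) :
    L ⊆ G.edges := by
  by_contra hL
  exact (PMF.mem_support_iff _ _).1 h
    (G.liveWeight_eq_zero L fun h => hL (Finset.mem_powerset.1 h))

theorem sampleRR_avg_mono {f g : Finset V × ℕ → ℝ≥0∞}
    (h : ∀ R c, R.card ≤ 1 + I.width R → c ≤ 1 + R.card + I.width R → f (R, c) ≤ g (R, c)) :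
    PMF.avg I.sampleRR f ≤ PMF.avg I.sampleRR g := by
  rw [sampleRR_avg, sampleRR_avg]
  refine PMF.avg_mono_support _ fun L hL => Finset.sum_le_sum fun v _ => mul_le_mul_right ?_ _
  refine h _ _ (I.card_reverseSearch_le (subset_of_mem_support_live _ hL) _ _) ?_
  have h1 := I.reverseSearch_steps_le L I.depth (subset_refl {v})
  rw [Finset.sdiff_self, Finset.sdiff_empty, Finset.sum_add_distrib, Finset.sum_const,
    smul_eq_mul, mul_one] at h1
  unfold width
  omega

theorem sampleRR_total_card_le :
    I.sampleRR.total (fun R => (R.card : ℝ≥0∞)) ≤ I.unitCost := by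
  unfold Comp.total unitCost meanWidth Comp.mean
  rw [Comp.expectedSteps_eq_avg, ← PMF.avg_add]
  calc _ ≤ PMF.avg I.sampleRR (fun r => 3 * (1 + (I.width r.1 : ℝ≥0∞))) := by
        refine I.sampleRR_avg_mono fun R c h1 h2 => ?_
        -- The search and the crediting each contribute `R.card`, and each is at most `1 + width`.
        have : c + R.card ≤ 3 * (1 + I.width R) := by omega
        dsimp only
        exact_mod_cast this
    _ = _ := by rw [PMF.avg_mul_left, PMF.avg_add, PMF.avg_const]

theorem sampleRR_mean_card_le : I.sampleRR.mean (fun R => (R.card : ℝ≥0∞)) ≤ I.unitCost :=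
  le_add_self.trans I.sampleRR_total_card_le

theorem modified_inDegree_seed {v : V} (hv : v ∈ I.seeds) : I.modified.inDegree v = 0 := by
  rw [Network.inDegree, Finset.card_eq_zero, Finset.filter_eq_empty_iff]
  intro e he h
  exact (Finset.mem_filter.1 he).2 (h ▸ hv)

theorem sum_inDegree : ∑ v ∈ Finset.univ \ I.seeds, I.modified.inDegree v = I.edgeCount := by
  unfold edgeCount Network.inDegree
  symm
  refine Finset.card_eq_sum_card_fiberwise fun e he => ?_
  simpa using (Finset.mem_filter.1 he).2

/-- Double counting: the width is the sum of the in-degrees over the members `v` of the set, and the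
number of roots `w` whose set contains `v` has expectation `U({v})`. -/
theorem meanWidth_eq : I.meanWidth
    = ENNReal.ofReal ((I.edgeCount : ℝ) / I.nonseedCount * I.expectedNodeValue) := by
  have h1 := I.sampleRR_mean_ofReal (g := fun R => (I.width R : ℝ)) fun R => Nat.cast_nonneg _
  simp only [ENNReal.ofReal_natCast] at h1
  unfold meanWidth
  rw [h1]
  congr 1
  have h2 : ∀ v ∈ Finset.univ \ I.seeds, I.value {v} = ∑ L, (I.net.live L).toReal
      * ∑ w ∈ Finset.univ \ I.seeds, if v ∈ I.reverseSet L w then (1 : ℝ) else 0 := by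
    intro v _
    rw [value_eq]
    simp [Finset.Nonempty]
  have h3 : ∀ R : Finset V, (I.width R : ℝ) = ∑ v ∈ Finset.univ \ I.seeds,
      (I.modified.inDegree v : ℝ) * if v ∈ R then (1 : ℝ) else 0 := by
    intro R
    unfold width
    push_cast
    simp only [mul_ite, mul_one, mul_zero]
    rw [← Finset.sum_filter]
    symm
    refine Finset.sum_subset (fun v hv => (Finset.mem_filter.1 hv).2) fun v hv hv' => ?_
    have : v ∈ I.seeds := by
      by_contra h
      exact hv' (Finset.mem_filter.2 ⟨by simpa using h, hv⟩)
    rw [I.modified_inDegree_seed this, Nat.cast_zero]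
  have h4 : (∑ w ∈ Finset.univ \ I.seeds, (I.modified.inDegree w : ℝ)) = I.edgeCount := by
    exact_mod_cast I.sum_inDegree
  have h5 : ∑ L, (I.net.live L).toReal
      * ∑ w ∈ Finset.univ \ I.seeds, (I.width (I.reverseSet L w) : ℝ)
      = ∑ v ∈ Finset.univ \ I.seeds, (I.modified.inDegree v : ℝ) * I.value {v} := by
    have h6 : ∀ v ∈ Finset.univ \ I.seeds, (I.modified.inDegree v : ℝ) * I.value {v} = _ :=
      fun v hv => congrArg _ (h2 v hv)
    rw [Finset.sum_congr rfl h6]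
    simp only [h3, Finset.mul_sum]
    symm
    rw [Finset.sum_comm' (t' := Finset.univ) (s' := fun _ => Finset.univ \ I.seeds) (by simp)]
    refine Finset.sum_congr rfl fun L _ => ?_
    rw [Finset.sum_comm]
    refine Finset.sum_congr rfl fun v _ => Finset.sum_congr rfl fun S _ => ?_
    ring
  rw [h5]
  unfold expectedNodeValue
  rw [h4]
  -- Without edges the in-degree weights are `0 / 0 = 0`, and both sides vanish.
  rcases Nat.eq_zero_or_pos I.edgeCount with h | h
  · have h6 : ∀ v ∈ Finset.univ \ I.seeds, I.modified.inDegree v = 0 :=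
      Finset.sum_eq_zero_iff.1 (I.sum_inDegree.trans h)
    rw [h, Finset.sum_eq_zero fun v hv => by rw [h6 v hv, Nat.cast_zero, zero_mul]]
    simp
  · have h7 : (0 : ℝ) < I.edgeCount := by exact_mod_cast h
    rw [Finset.mul_sum, Finset.sum_div]
    refine Finset.sum_congr rfl fun v _ => ?_
    field_simp

theorem one_le_value {v : V} (hv : v ∉ I.seeds) : 1 ≤ I.value {v} := by
  rw [value_eq]
  conv_lhs => rw [← sum_toReal_live I.net]
  refine Finset.sum_le_sum fun L _ => le_mul_of_one_le_right ENNReal.toReal_nonneg ?_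
  have h : v ∈ I.reverseSet L v := (I.mem_reverseSearch _ _ _ _).2 (Within.refl _ _ _)
  calc (1 : ℝ) = if (I.reverseSet L v ∩ {v}).Nonempty then (1 : ℝ) else 0 := by
        rw [if_pos ⟨v, by simp [h]⟩]
    _ ≤ _ := Finset.single_le_sum
        (f := fun w => if (I.reverseSet L w ∩ {v}).Nonempty then (1 : ℝ) else 0)
        (fun w _ => by split_ifs <;> norm_num) (by simpa using hv)

theorem expectedNodeValue_nonneg : 0 ≤ I.expectedNodeValue := by
  refine Finset.sum_nonneg fun v hv => mul_nonneg (by positivity) ?_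
  exact zero_le_one.trans (I.one_le_value (Finset.mem_sdiff.1 hv).2)

theorem one_le_expectedNodeValue (h : 0 < I.edgeCount) : 1 ≤ I.expectedNodeValue := by
  have h4 : (∑ w ∈ Finset.univ \ I.seeds, (I.modified.inDegree w : ℝ)) = I.edgeCount := by
    exact_mod_cast I.sum_inDegree
  have h7 : (0 : ℝ) < I.edgeCount := by exact_mod_cast h
  unfold expectedNodeValue
  calc (1 : ℝ) = ∑ v ∈ Finset.univ \ I.seeds, (I.modified.inDegree v : ℝ)
        / (∑ w ∈ Finset.univ \ I.seeds, (I.modified.inDegree w : ℝ)) := by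
        rw [← Finset.sum_div, h4, div_self h7.ne']
    _ ≤ _ := Finset.sum_le_sum fun v hv => le_mul_of_one_le_right (by positivity)
        (I.one_le_value (Finset.mem_sdiff.1 hv).2)

end Attribution

namespace Attribution

variable {V : Type*} [Fintype V] [DecidableEq V] (I : Attribution V)

/-! ### Collecting random sets -/

theorem collect_expectedSteps_le (m : ℕ) (est : V → ℝ) :
    (I.collect m est).expectedSteps ≤ m * I.unitCost := by
  induction m generalizing est with
  | zero => rw [collect, Comp.expectedSteps_ret]; exact zero_le
  | succ m ih =>
    rw [collect, Comp.expectedSteps_andThen_eq_total]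
    simp only [Comp.expectedSteps_tick]
    calc _ ≤ I.sampleRR.total (fun R => (R.card : ℝ≥0∞) + m * I.unitCost) := by
          exact add_le_add_right (Comp.mean_mono _ fun R => add_le_add_right (ih _) _) _
      _ = I.sampleRR.total (fun R => (R.card : ℝ≥0∞)) + m * I.unitCost := by
          rw [Comp.total, Comp.mean_add, Comp.mean_const, ← add_assoc, Comp.total]
      _ ≤ I.unitCost + m * I.unitCost := add_le_add_left I.sampleRR_total_card_le _
      _ = _ := by push_cast; ring

theorem collect_mean_succ (m : ℕ) (est : V → ℝ) (φ : (V → ℝ) → ℝ≥0∞) :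
    (I.collect (m + 1) est).mean φ
      = I.sampleRR.mean fun R => (I.collect m (I.credit R est)).mean φ := by
  rw [collect, Comp.mean_andThen]
  simp only [Comp.mean_tick]

/-- Consecutive batches act as one batch. This lets the counters of a round be analysed as those of
a single fresh batch. -/
theorem collect_mean_add (a b : ℕ) (est : V → ℝ) (φ : (V → ℝ) → ℝ≥0∞) :
    (I.collect (a + b) est).mean φ
      = (I.collect a est).mean fun e => (I.collect b e).mean φ := by
  induction a generalizing est with
  | zero => rw [zero_add, collect, Comp.mean_ret]
  | succ a ih =>
    rw [show a + 1 + b = a + b + 1 by ring, collect_mean_succ, collect_mean_succ]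
    simp only [ih]

theorem touched_credit_le (R : Finset V) (est : V → ℝ) :
    I.touched (I.credit R est) ≤ I.touched est + R.card := by
  classical
  unfold touched
  refine (Finset.card_le_card ?_).trans (Finset.card_union_le _ R)
  intro t ht
  obtain ⟨h1, h2⟩ := Finset.mem_filter.1 ht
  rw [Finset.mem_union, Finset.mem_filter]
  by_cases h : t ∈ R
  · exact Or.inr h
  · refine Or.inl ⟨h1, ?_⟩
    rwa [credit, if_neg fun h' => h (Finset.mem_inter.1 h').1] at h2

theorem touched_le (est : V → ℝ) : I.touched est ≤ I.seeds.card := by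
  unfold touched
  exact Finset.card_filter_le _ _

theorem touched_zero : I.touched (fun _ => 0) = 0 := by
  unfold touched
  simp

/-- A set makes at most `R.card` counters nonzero, so scanning the counters is charged to the sets.
Charging `|T|` in every round would be too much when the `k`-th Shapley value is large. -/
theorem collect_mean_touched_le (m : ℕ) (est : V → ℝ) :
    (I.collect m est).mean (fun e => (I.touched e : ℝ≥0∞))
      ≤ I.touched est + m * I.unitCost := by
  induction m generalizing est with
  | zero => rw [collect, Comp.mean_ret]; exact le_self_add
  | succ m ih =>
    rw [collect_mean_succ]
    calc _ ≤ I.sampleRR.mean (fun R => (I.touched est + m * I.unitCost) + (R.card : ℝ≥0∞)) := by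
          refine Comp.mean_mono _ fun R => (ih _).trans ?_
          have : (I.touched (I.credit R est) : ℝ≥0∞) ≤ I.touched est + R.card := by
            exact_mod_cast I.touched_credit_le R est
          calc _ ≤ _ := add_le_add_left this _
            _ = _ := by ring
      _ ≤ (I.touched est + m * I.unitCost) + I.unitCost := by
          rw [Comp.mean_add, Comp.mean_const]
          exact add_le_add_right I.sampleRR_mean_card_le _
      _ = _ := by push_cast; ring

/-! ### Lower tail of the counters -/

/-- From `1 + x + x²/2 ≤ exp x` and `(1 + x + x²/2)(1 - x + x²/2) = 1 + x⁴/4 ≥ 1`. -/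
theorem sub_sq_half_le_one_sub_exp_neg {x : ℝ} (hx : 0 ≤ x) :
    x - x ^ 2 / 2 ≤ 1 - Real.exp (-x) := by
  have h1 := Real.quadratic_le_exp_of_nonneg hx
  have h2 : 0 < 1 + x + x ^ 2 / 2 := by positivity
  have h3 : Real.exp (-x) ≤ (1 + x + x ^ 2 / 2)⁻¹ := by
    rw [Real.exp_neg]; exact inv_anti₀ h2 h1
  have h4 : (1 + x + x ^ 2 / 2)⁻¹ ≤ 1 - x + x ^ 2 / 2 := by
    rw [inv_le_iff_one_le_mul₀ h2]
    nlinarith [sq_nonneg (x ^ 2)]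
  linarith

/-- The chord of the convex function `y ↦ exp (-(x * y))` on `[0, 1]` lies above it. Thus fractional
shares are no worse than 0/1 variables in the Chernoff bound. -/
theorem exp_neg_mul_le {x y : ℝ} (hy0 : 0 ≤ y) (hy1 : y ≤ 1) :
    Real.exp (-(x * y)) + (1 - Real.exp (-x)) * y ≤ 1 := by
  have h := convexOn_exp.2 (Set.mem_univ (-x)) (Set.mem_univ 0) hy0 (sub_nonneg.2 hy1)
    (add_sub_cancel _ _)
  simp only [smul_eq_mul, mul_zero, add_zero, Real.exp_zero, mul_one] at h
  rw [show y * -x = -(x * y) by ring] at h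
  linarith

theorem sampleRR_mean_exp_le {t : V} (ht : t ∈ I.seeds) {x : ℝ} (hx : 0 ≤ x) :
    I.sampleRR.mean (fun R => ENNReal.ofReal (Real.exp (-(x * I.share t R))))
      ≤ ENNReal.ofReal (Real.exp
        (-(I.net.shapley I.seeds I.depth t / I.nonseedCount * (x - x ^ 2 / 2)))) := by
  set μ := I.net.shapley I.seeds I.depth t / I.nonseedCount with hμ
  have hμ0 : 0 ≤ μ := div_nonneg (I.shapley_nonneg ht) (Nat.cast_nonneg _)
  have hc : 0 ≤ 1 - Real.exp (-x) := by
    have := Real.exp_le_one_iff.2 (neg_nonpos.2 hx); linarith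
  -- Stated as a sum, because subtraction in `ℝ≥0∞` is truncated.
  have h1 : I.sampleRR.mean (fun R => ENNReal.ofReal (Real.exp (-(x * I.share t R))))
      + ENNReal.ofReal ((1 - Real.exp (-x)) * μ) ≤ 1 := by
    rw [ENNReal.ofReal_mul hc, ← I.sampleRR_mean_share ht, ← Comp.mean_mul_left, ← Comp.mean_add]
    calc _ ≤ I.sampleRR.mean (fun _ => 1) := by
          refine Comp.mean_mono _ fun R => ?_
          rw [← ENNReal.ofReal_mul hc, ← ENNReal.ofReal_add (Real.exp_nonneg _)
            (mul_nonneg hc (I.share_nonneg t R)), ← ENNReal.ofReal_one]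
          exact ENNReal.ofReal_le_ofReal (exp_neg_mul_le (I.share_nonneg t R) (I.share_le_one t R))
      _ = 1 := Comp.mean_const _ _
  calc _ ≤ 1 - ENNReal.ofReal ((1 - Real.exp (-x)) * μ) :=
        ENNReal.le_sub_of_add_le_right ENNReal.ofReal_ne_top h1
    _ = ENNReal.ofReal (1 - (1 - Real.exp (-x)) * μ) := by
        rw [ENNReal.ofReal_sub _ (mul_nonneg hc hμ0), ENNReal.ofReal_one]
    _ ≤ _ := by
        refine ENNReal.ofReal_le_ofReal ?_
        have h2 := Real.add_one_le_exp (-(μ * (x - x ^ 2 / 2)))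
        have h3 := mul_le_mul_of_nonneg_left (sub_sq_half_le_one_sub_exp_neg hx) hμ0
        linarith

theorem collect_mean_exp_le {t : V} (ht : t ∈ I.seeds) {x : ℝ} (hx : 0 ≤ x) (m : ℕ)
    (est : V → ℝ) :
    (I.collect m est).mean (fun e => ENNReal.ofReal (Real.exp (-(x * e t))))
      ≤ ENNReal.ofReal (Real.exp (-(x * est t)
        - m * (I.net.shapley I.seeds I.depth t / I.nonseedCount * (x - x ^ 2 / 2)))) := by
  induction m generalizing est with
  | zero => rw [collect, Comp.mean_ret]; simp
  | succ m ih =>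
    set y := I.net.shapley I.seeds I.depth t / I.nonseedCount * (x - x ^ 2 / 2) with hy
    rw [collect_mean_succ]
    calc _ ≤ I.sampleRR.mean (fun R => ENNReal.ofReal (Real.exp (-(x * est t) - m * y))
            * ENNReal.ofReal (Real.exp (-(x * I.share t R)))) := by
          refine Comp.mean_mono _ fun R => (ih _).trans_eq ?_
          rw [← ENNReal.ofReal_mul (Real.exp_nonneg _), ← Real.exp_add, credit_eq]
          congr 2; ring
      _ ≤ ENNReal.ofReal (Real.exp (-(x * est t) - m * y)) * ENNReal.ofReal (Real.exp (-y)) := by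
          rw [Comp.mean_mul_left]
          exact mul_le_mul_right (I.sampleRR_mean_exp_le ht hx) _
      _ = _ := by
          rw [← ENNReal.ofReal_mul (Real.exp_nonneg _), ← Real.exp_add]
          congr 2; push_cast; ring

-- Markov's inequality for `exp (-(δ * e t))`. With mean `M` and `a ≤ (1 - δ) M` the exponent is at
-- most `δ(1 - δ)M - (δ - δ²/2)M = -M δ²/2`.
open Classical in
theorem collect_tail_le {t : V} (ht : t ∈ I.seeds) {δ a : ℝ} (hδ : 0 ≤ δ) (m : ℕ)
    (ha : a ≤ (1 - δ) * (m * (I.net.shapley I.seeds I.depth t / I.nonseedCount))) :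
    (I.collect m fun _ => 0).mean (fun e => if e t < a then 1 else 0)
      ≤ ENNReal.ofReal (Real.exp
        (-(m * (I.net.shapley I.seeds I.depth t / I.nonseedCount) * (δ ^ 2 / 2)))) := by
  calc _ ≤ (I.collect m fun _ => 0).mean (fun e => ENNReal.ofReal (Real.exp (δ * a))
          * ENNReal.ofReal (Real.exp (-(δ * e t)))) := by
        refine Comp.mean_mono _ fun e => ?_
        rw [← ENNReal.ofReal_mul (Real.exp_nonneg _), ← Real.exp_add]
        split_ifs with h
        · rw [← ENNReal.ofReal_one]
          refine ENNReal.ofReal_le_ofReal (Real.one_le_exp ?_)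
          have := mul_le_mul_of_nonneg_left h.le hδ
          linarith
        · exact zero_le
    _ ≤ ENNReal.ofReal (Real.exp (δ * a)) * ENNReal.ofReal (Real.exp (-(δ * 0)
          - m * (I.net.shapley I.seeds I.depth t / I.nonseedCount * (δ - δ ^ 2 / 2)))) := by
        rw [Comp.mean_mul_left]
        exact mul_le_mul_right (I.collect_mean_exp_le ht hδ m _) _
    _ ≤ _ := by
        rw [← ENNReal.ofReal_mul (Real.exp_nonneg _), ← Real.exp_add]
        refine ENNReal.ofReal_le_ofReal (Real.exp_le_exp.2 ?_)
        have := mul_le_mul_of_nonneg_left ha hδ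
        linarith

open Classical in
/-- The probability that the `k`-th largest counter is far below its expectation. -/
theorem collect_kthLargest_tail_le {k : ℕ} (hk : 1 ≤ k) (hkT : k ≤ I.seeds.card) {δ a : ℝ}
    (hδ : 0 ≤ δ) (hδ1 : δ ≤ 1) (m : ℕ)
    (ha : a ≤ (1 - δ) * (m * (I.shapleyKth k / I.nonseedCount))) :
    (I.collect m fun _ => 0).mean (fun e => if kthLargest I.seeds e k < a then 1 else 0)
      ≤ ENNReal.ofReal (k * Real.exp
        (-(m * (I.shapleyKth k / I.nonseedCount) * (δ ^ 2 / 2)))) := by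
  -- `A` consists of `k` seeds of large Shapley value. If all their counters reached `a`, so would
  -- the `k`-th largest one; the union bound therefore costs only the factor `k`.
  obtain ⟨A, hA, hAk⟩ := Finset.exists_subset_card_eq
    (le_card_filter_kthLargest_le I.seeds (I.net.shapley I.seeds I.depth) hk hkT)
  have hAT : ∀ t ∈ A, t ∈ I.seeds ∧ I.shapleyKth k ≤ I.net.shapley I.seeds I.depth t :=
    fun t ht => Finset.mem_filter.1 (hA ht)
  have hle : ∀ t ∈ A, (m : ℝ) * (I.shapleyKth k / I.nonseedCount)
      ≤ m * (I.net.shapley I.seeds I.depth t / I.nonseedCount) := fun t ht => by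
    have := (hAT t ht).2
    gcongr
  calc _ ≤ (I.collect m fun _ => 0).mean (fun e => ∑ t ∈ A, if e t < a then 1 else 0) := by
        refine Comp.mean_mono _ fun e => ?_
        split_ifs with h
        · obtain ⟨t, ht, hta⟩ : ∃ t ∈ A, e t < a := by
            by_contra! h'
            refine h.not_ge (le_kthLargest _ _ hk ?_)
            rw [← hAk]
            exact Finset.card_le_card fun t ht => Finset.mem_filter.2 ⟨(hAT t ht).1, h' t ht⟩
          calc (1 : ℝ≥0∞) = if e t < a then 1 else 0 := (if_pos hta).symm
            _ ≤ _ := Finset.single_le_sum (f := fun t => if e t < a then (1 : ℝ≥0∞) else 0)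
              (fun _ _ => zero_le) ht
        · exact zero_le
    _ ≤ ∑ t ∈ A, ENNReal.ofReal (Real.exp
        (-(m * (I.shapleyKth k / I.nonseedCount) * (δ ^ 2 / 2)))) := by
        rw [Comp.mean_finset_sum]
        refine Finset.sum_le_sum fun t ht => ?_
        refine (I.collect_tail_le (hAT t ht).1 hδ m (ha.trans ?_)).trans ?_
        · exact mul_le_mul_of_nonneg_left (hle t ht) (sub_nonneg.2 hδ1)
        · refine ENNReal.ofReal_le_ofReal (Real.exp_le_exp.2 (neg_le_neg ?_))
          exact mul_le_mul_of_nonneg_right (hle t ht) (by positivity)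
    _ = _ := by
        rw [Finset.sum_const, hAk, nsmul_eq_mul, ENNReal.ofReal_mul (Nat.cast_nonneg _),
          ENNReal.ofReal_natCast]

/-! ### The rounds of phase 1 -/

/-- The stopping condition of round `i`. -/
def Stops (ε l : ℝ) (k i : ℕ) (est : V → ℝ) : Prop :=
  (I.nonseedCount : ℝ) * (kthLargest I.seeds est k / I.roundTotal ε l i)
    ≥ (1 + √2 * ε) * I.guess i

theorem guess_pos (i : ℕ) : 0 < I.guess i := by
  have : (0 : ℝ) < I.nonseedCount := by exact_mod_cast I.nonseedCount_pos
  unfold guess; positivity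

theorem guess_anti {i j : ℕ} (h : i ≤ j) : I.guess j ≤ I.guess i := by
  unfold guess
  have : (2 : ℝ) ^ i ≤ 2 ^ j := pow_le_pow_right₀ one_le_two h
  gcongr

theorem one_le_guess {i : ℕ} (h : i ≤ Nat.log 2 I.nonseedCount) : 1 ≤ I.guess i := by
  unfold guess
  rw [one_le_div (by positivity)]
  have h1 := Nat.pow_le_pow_right two_pos h
  have h2 := Nat.pow_log_le_self 2 I.nonseedCount_pos.ne'
  exact_mod_cast h1.trans h2

-- Unrolls one round. On stopping, the condition of round `i` says that the returned bound is at
-- least `guess i`, and the continuation cost `φ` decreases in this bound.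
open Classical in
theorem thresholdRounds_total_succ_le {ε : ℝ} (hε : 0 < ε) (l : ℝ) (k r i : ℕ) (est : V → ℝ)
    {φ : ℝ → ℝ≥0∞} (hφ : ∀ x y, 0 < x → x ≤ y → φ y ≤ φ x) :
    (I.thresholdRounds ε l k (r + 1) i est).total φ
      ≤ ((I.roundTotal ε l i - I.roundTotal ε l (i - 1) : ℕ) : ℝ≥0∞) * I.unitCost
        + (I.collect (I.roundTotal ε l i - I.roundTotal ε l (i - 1)) est).mean fun e =>
          1 + I.touched e + if I.Stops ε l k i e then φ (I.guess i)
            else (I.thresholdRounds ε l k r (i + 1) e).total φ := by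
  rw [thresholdRounds, Comp.total_andThen]
  unfold Comp.total
  refine add_le_add (I.collect_expectedSteps_le _ _) (Comp.mean_mono _ fun e => ?_)
  simp only [Comp.expectedSteps_tick, Comp.mean_tick]
  push_cast
  rw [add_assoc]
  refine add_le_add_right ?_ _
  by_cases h : I.Stops ε l k i e
  · rw [if_pos h]
    unfold Stops at h
    rw [if_pos h]
    rw [Comp.expectedSteps_ret, Comp.mean_ret, zero_add]
    refine hφ _ _ (I.guess_pos i) ?_
    rw [← div_div, ← mul_div_assoc, le_div_iff₀ (by positivity), mul_comm]
    exact h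
  · rw [if_neg h]
    unfold Stops at h
    rw [if_neg h]

/-- The worst case, used after a missed round: all rounds from `i` to `M` are run, each scan costs
`|T|`, and the final bound is only known to be at least 1. -/
theorem thresholdRounds_total_le_crude {ε : ℝ} (hε : 0 < ε) (l : ℝ) (k : ℕ)
    {φ : ℝ → ℝ≥0∞} (hφ : ∀ x y, 0 < x → x ≤ y → φ y ≤ φ x)
    (hmono : ∀ i j, i ≤ j → I.roundTotal ε l i ≤ I.roundTotal ε l j) {M : ℕ}
    (hM : M ≤ Nat.log 2 I.nonseedCount) (r i : ℕ) (hi : 1 ≤ i) (hr : i + r = M + 1)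
    (est : V → ℝ) :
    (I.thresholdRounds ε l k r i est).total φ
      ≤ r * (1 + I.seeds.card)
        + ((I.roundTotal ε l M - I.roundTotal ε l (i - 1) : ℕ) : ℝ≥0∞) * I.unitCost + φ 1 := by
  classical
  induction r generalizing i est with
  | zero => rw [thresholdRounds, Comp.total_ret]; exact le_add_self
  | succ r ih =>
    refine (I.thresholdRounds_total_succ_le hε l k r i est hφ).trans ?_
    set d := I.roundTotal ε l i - I.roundTotal ε l (i - 1) with hd
    set D := I.roundTotal ε l M - I.roundTotal ε l i with hD
    have hsum : I.roundTotal ε l M - I.roundTotal ε l (i - 1) = d + D := by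
      have h1 := hmono (i - 1) i (by omega)
      have h2 := hmono i M (by omega)
      omega
    calc _ ≤ (d : ℝ≥0∞) * I.unitCost + (I.collect d est).mean (fun _ => 1 + I.seeds.card
            + (r * (1 + I.seeds.card) + D * I.unitCost + φ 1)) := by
          refine add_le_add_right (Comp.mean_mono _ fun e => ?_) _
          have h1 : (I.touched e : ℝ≥0∞) ≤ I.seeds.card := by exact_mod_cast I.touched_le e
          refine add_le_add (add_le_add_right h1 _) ?_
          split_ifs with h
          · exact (hφ 1 _ one_pos (I.one_le_guess (by omega))).trans le_add_self
          · exact ih (i + 1) (by omega) (by omega) e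
      _ = _ := by
          rw [Comp.mean_const, hsum]; push_cast; ring

open Classical in
/-- The probability that round `i` does not stop after `m` more random sets. -/
noncomputable def missProb (ε l : ℝ) (k i m : ℕ) (est : V → ℝ) : ℝ≥0∞ :=
  (I.collect m est).mean fun e => if I.Stops ε l k i e then 0 else 1

theorem missProb_le_one (ε l : ℝ) (k i m : ℕ) (est : V → ℝ) :
    I.missProb ε l k i m est ≤ 1 := by
  classical
  unfold missProb
  calc _ ≤ (I.collect m est).mean (fun _ => 1) :=
        Comp.mean_mono _ fun e => by split_ifs <;> simp
    _ = 1 := Comp.mean_const _ _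

/-- The expected cost of the rounds, if all rounds after round `j` together cost at most `B`. -/
theorem thresholdRounds_total_le {ε : ℝ} (hε : 0 < ε) (l : ℝ) (k : ℕ)
    {φ : ℝ → ℝ≥0∞} (hφ : ∀ x y, 0 < x → x ≤ y → φ y ≤ φ x)
    (hmono : ∀ i j, i ≤ j → I.roundTotal ε l i ≤ I.roundTotal ε l j) {j r' : ℕ} {B : ℝ≥0∞}
    (hB : ∀ e, (I.thresholdRounds ε l k r' (j + 1) e).total φ ≤ B) (r i : ℕ) (hi : 1 ≤ i)
    (hr : i + r = j) (est : V → ℝ) :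
    (I.thresholdRounds ε l k (r' + r + 1) i est).total φ
      ≤ ∑ a ∈ Finset.range (r + 1), (1 + I.touched est
          + ((I.roundTotal ε l (i + a) - I.roundTotal ε l (i - 1) : ℕ) : ℝ≥0∞) * I.unitCost)
        + ((I.roundTotal ε l j - I.roundTotal ε l (i - 1) : ℕ) : ℝ≥0∞) * I.unitCost
        + φ (I.guess j)
        + I.missProb ε l k j (I.roundTotal ε l j - I.roundTotal ε l (i - 1)) est * B := by
  classical
  induction r generalizing i est with
  | zero =>
    obtain rfl : i = j := by omega
    refine (I.thresholdRounds_total_succ_le hε l k _ i est hφ).trans ?_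
    set d := I.roundTotal ε l i - I.roundTotal ε l (i - 1) with hd
    calc _ ≤ (d : ℝ≥0∞) * I.unitCost + (I.collect d est).mean (fun e => 1 + I.touched e
            + (φ (I.guess i) + (if I.Stops ε l k i e then 0 else 1) * B)) := by
          refine add_le_add_right (Comp.mean_mono _ fun e => add_le_add_right ?_ _) _
          split_ifs with h
          · exact le_self_add
          · rw [one_mul]; exact (hB e).trans le_add_self
      _ = (d : ℝ≥0∞) * I.unitCost + (1 + (I.collect d est).mean (fun e => (I.touched e : ℝ≥0∞))
            + (φ (I.guess i) + I.missProb ε l k i d est * B)) := by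
          rw [Comp.mean_add, Comp.mean_add, Comp.mean_add, Comp.mean_const, Comp.mean_const,
            Comp.mean_mul_right]
          rfl
      _ ≤ (d : ℝ≥0∞) * I.unitCost + (1 + (I.touched est + d * I.unitCost)
            + (φ (I.guess i) + I.missProb ε l k i d est * B)) := by
          gcongr
          exact I.collect_mean_touched_le _ _
      _ = _ := by
          simp only [zero_add, Finset.sum_range_one, add_zero]
          rw [← hd]
          ring
  | succ r ih =>
    rw [show r' + (r + 1) + 1 = (r' + r + 1) + 1 by ring]
    refine (I.thresholdRounds_total_succ_le hε l k _ i est hφ).trans ?_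
    set d := I.roundTotal ε l i - I.roundTotal ε l (i - 1) with hd
    set D := I.roundTotal ε l j - I.roundTotal ε l i with hD
    have hsum : ∀ b, i ≤ b → I.roundTotal ε l b - I.roundTotal ε l (i - 1)
        = d + (I.roundTotal ε l b - I.roundTotal ε l i) := by
      intro b hb
      have h1 := hmono (i - 1) i (by omega)
      have h2 := hmono i b hb
      omega
    set s : ℕ → ℕ := fun a => I.roundTotal ε l (i + 1 + a) - I.roundTotal ε l i with hs
    -- The counters are not reset between rounds, so a miss of round `j` depends on the first `d`
    -- and the next `D` sets together.
    have hmiss : (I.collect d est).mean (fun e => I.missProb ε l k j D e)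
        = I.missProb ε l k j (d + D) est := by
      unfold missProb
      rw [collect_mean_add]
    calc _ ≤ (d : ℝ≥0∞) * I.unitCost + (I.collect d est).mean (fun e => 1 + I.touched e
            + (∑ a ∈ Finset.range (r + 1), (1 + I.touched e + (s a : ℝ≥0∞) * I.unitCost)
              + D * I.unitCost + φ (I.guess j) + I.missProb ε l k j D e * B)) := by
          refine add_le_add_right (Comp.mean_mono _ fun e => add_le_add_right ?_ _) _
          split_ifs with h
          -- An early stop leaves a guess no smaller than `guess j`, so `φ (guess j)` covers it; the
          -- other summands are slack.
          · refine (hφ _ _ (I.guess_pos j) (I.guess_anti (by omega))).trans ?_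
            exact le_add_self.trans le_self_add
          · exact ih (i + 1) (by omega) (by omega) e
      _ = (d : ℝ≥0∞) * I.unitCost + (1 + (I.collect d est).mean (fun e => (I.touched e : ℝ≥0∞))
            + (∑ a ∈ Finset.range (r + 1), (1
                + (I.collect d est).mean (fun e => (I.touched e : ℝ≥0∞))
                + (s a : ℝ≥0∞) * I.unitCost)
              + D * I.unitCost + φ (I.guess j) + I.missProb ε l k j (d + D) est * B)) := by
          simp only [Comp.mean_add, Comp.mean_const, Comp.mean_mul_right, Comp.mean_finset_sum,
            hmiss]
      _ ≤ (d : ℝ≥0∞) * I.unitCost + (1 + (I.touched est + d * I.unitCost)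
            + (∑ a ∈ Finset.range (r + 1), (1 + (I.touched est + d * I.unitCost)
                + (s a : ℝ≥0∞) * I.unitCost)
              + D * I.unitCost + φ (I.guess j) + I.missProb ε l k j (d + D) est * B)) := by
          have := I.collect_mean_touched_le d est
          gcongr
      _ = _ := by
          rw [Finset.sum_range_succ' _ (r + 1), hsum j (by omega), ← hD, add_zero, ← hd]
          have h1 : ∀ a ∈ Finset.range (r + 1), (1 + (I.touched est : ℝ≥0∞)
              + ((I.roundTotal ε l (i + (a + 1)) - I.roundTotal ε l (i - 1) : ℕ) : ℝ≥0∞)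
                * I.unitCost)
              = 1 + (I.touched est + d * I.unitCost) + (s a : ℝ≥0∞) * I.unitCost := by
            intro a _
            rw [hsum _ (by omega), hs, show i + (a + 1) = i + 1 + a by ring]
            push_cast
            ring
          rw [Finset.sum_congr rfl h1]
          push_cast
          ring

/-- The expected cost of phase 2, given the lower bound of phase 1. -/
theorem phaseTwo_expectedSteps_le (m : ℕ) (f : (V → ℝ) → V → ℝ) :
    (Comp.tick 1 <| Comp.andThen (I.collect m fun _ => 0) fun est =>
        Comp.tick (1 + I.touched est) <| Comp.ret (f est)).expectedSteps
      ≤ 2 + 2 * (m * I.unitCost) := by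
  rw [Comp.expectedSteps_tick, Comp.expectedSteps_andThen]
  simp only [Comp.expectedSteps_tick, Comp.expectedSteps_ret, add_zero, Nat.cast_add,
    Nat.cast_one, Comp.mean_add, Comp.mean_const]
  have h1 := I.collect_expectedSteps_le m fun _ => 0
  have h2 := I.collect_mean_touched_le m fun _ => 0
  rw [I.touched_zero, Nat.cast_zero, zero_add] at h2
  calc _ ≤ 1 + (m * I.unitCost + (1 + m * I.unitCost)) := by gcongr
    _ = _ := by ring

theorem approxRRset_expectedSteps_le (ε l : ℝ) (k : ℕ) :
    (I.approxRRset ε l k).expectedSteps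
      ≤ 1 + (I.thresholdRounds ε l k (Nat.log 2 I.nonseedCount - 1) 1 fun _ => 0).total
        fun LB => 2 + 2 * (I.sampleCount ε l LB * I.unitCost) := by
  rw [approxRRset, Comp.expectedSteps_andThen_eq_total, estimateThreshold, Comp.total_tick,
    Nat.cast_one]
  refine add_le_add_right ?_ _
  unfold Comp.total
  exact add_le_add_right (Comp.mean_mono _ fun LB => I.phaseTwo_expectedSteps_le _ _) _

end Attribution

/-! ### Sample sizes -/

theorem Real.half_lt_log_two : (1 / 2 : ℝ) < Real.log 2 := by
  have := Real.log_two_gt_d9; linarith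

theorem Real.one_le_logb_two_natCast {N : ℕ} (h : 2 ≤ N) : 1 ≤ Real.logb 2 N := by
  have h2 : (2 : ℝ) ≤ N := by exact_mod_cast h
  rw [Real.le_logb_iff_rpow_le one_lt_two (by linarith), Real.rpow_one]
  exact h2

theorem Real.logb_two_le {x : ℝ} (hx : 1 ≤ x) : Real.logb 2 x ≤ 2 * Real.log x := by
  have h1 := Real.half_lt_log_two
  have h2 := Real.log_nonneg hx
  rw [← Real.log_div_log, div_le_iff₀ (by linarith)]
  nlinarith

theorem Real.sqrt_two_le_two : √2 ≤ 2 := by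
  rw [Real.sqrt_le_left (by norm_num)]; norm_num

namespace Attribution

variable {V : Type*} [Fintype V] [DecidableEq V] (I : Attribution V)

/-- The logarithmic factor of the sample sizes of phase 1. -/
noncomputable def logFactor (l : ℝ) : ℝ :=
  l * Real.log I.nonseedCount + Real.log I.seeds.card
    + Real.log (Real.logb 2 I.nonseedCount) + Real.log 2

theorem nonseedCount_le_card : I.nonseedCount ≤ Fintype.card V := Finset.card_le_univ _

/-- The standing assumptions on the parameters. -/
structure Admissible (ε₀ l₀ ε l : ℝ) : Prop where
  l₀_pos : 0 < l₀
  l₀_le : l₀ ≤ l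
  ε_pos : 0 < ε
  ε_le : ε ≤ ε₀
  two_le : 2 ≤ I.nonseedCount
  one_le : 1 ≤ I.seeds.card

namespace Admissible

variable {I} {ε₀ l₀ ε l : ℝ}

theorem l_pos (h : I.Admissible ε₀ l₀ ε l) : 0 < l := h.l₀_pos.trans_le h.l₀_le

theorem ε₀_pos (h : I.Admissible ε₀ l₀ ε l) : 0 < ε₀ := h.ε_pos.trans_le h.ε_le

theorem log_two_le (h : I.Admissible ε₀ l₀ ε l) : Real.log 2 ≤ Real.log I.nonseedCount :=
  Real.log_le_log two_pos (by exact_mod_cast h.two_le)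

theorem log_nonseedCount_le (_h : I.Admissible ε₀ l₀ ε l) :
    Real.log I.nonseedCount ≤ Real.log (Fintype.card V) :=
  Real.log_le_log (by exact_mod_cast I.nonseedCount_pos) (by exact_mod_cast I.nonseedCount_le_card)

theorem log_card_pos (h : I.Admissible ε₀ l₀ ε l) : 0 < Real.log (Fintype.card V) := by
  have := h.log_two_le; have := h.log_nonseedCount_le; have := Real.half_lt_log_two
  linarith

theorem log_seeds_nonneg (h : I.Admissible ε₀ l₀ ε l) : 0 ≤ Real.log I.seeds.card :=
  Real.log_nonneg (by exact_mod_cast h.one_le)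

theorem log_seeds_le (h : I.Admissible ε₀ l₀ ε l) :
    Real.log I.seeds.card ≤ Real.log (Fintype.card V) :=
  Real.log_le_log (by exact_mod_cast h.one_le) (by exact_mod_cast Finset.card_le_univ _)

theorem logb_le (h : I.Admissible ε₀ l₀ ε l) :
    Real.logb 2 I.nonseedCount ≤ 2 * Real.log (Fintype.card V) := by
  have h1 : (1 : ℝ) ≤ I.nonseedCount := by exact_mod_cast I.nonseedCount_pos
  have := Real.logb_two_le h1
  have := h.log_nonseedCount_le
  linarith

theorem logFactor_pos (h : I.Admissible ε₀ l₀ ε l) : 0 < I.logFactor l := by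
  have h1 := h.log_seeds_nonneg
  have h2 := Real.log_nonneg (Real.one_le_logb_two_natCast h.two_le)
  have h3 := Real.half_lt_log_two
  have h4 : 0 ≤ l * Real.log I.nonseedCount :=
    mul_nonneg h.l_pos.le (by have := h.log_two_le; linarith)
  unfold logFactor
  linarith

theorem log_card_le (h : I.Admissible ε₀ l₀ ε l) :
    Real.log (Fintype.card V) ≤ 1 / l₀ * (l * Real.log (Fintype.card V)) := by
  rw [← mul_assoc, one_div_mul_eq_div]
  exact le_mul_of_one_le_left h.log_card_pos.le ((one_le_div h.l₀_pos).2 h.l₀_le)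

/-- The terms other than `l * log n'` add up to at most `4 log n`, which `l₀ ≤ l` turns into a
multiple of `l * log n`. -/
theorem logFactor_le (h : I.Admissible ε₀ l₀ ε l) :
    I.logFactor l ≤ (1 + 4 / l₀) * (l * Real.log (Fintype.card V)) := by
  have h1 := h.log_seeds_le
  have h2 := Real.log_le_sub_one_of_pos
    (zero_lt_one.trans_le (Real.one_le_logb_two_natCast h.two_le))
  have h3 := h.logb_le
  have h4 : l * Real.log I.nonseedCount ≤ l * Real.log (Fintype.card V) :=
    mul_le_mul_of_nonneg_left h.log_nonseedCount_le h.l_pos.le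
  have h5 := h.log_card_le
  have h6 := h.log_two_le
  have h7 := h.log_nonseedCount_le
  have h8 : (1 + 4 / l₀) * (l * Real.log (Fintype.card V))
    = l * Real.log (Fintype.card V) + 4 * (1 / l₀ * (l * Real.log (Fintype.card V))) := by ring
  unfold logFactor
  linarith

theorem logFactor_phaseTwo_nonneg (h : I.Admissible ε₀ l₀ ε l) :
    0 ≤ l * Real.log I.nonseedCount + Real.log I.seeds.card + Real.log 4 := by
  have h1 := h.log_seeds_nonneg
  have h3 : 0 ≤ Real.log 4 := Real.log_nonneg (by norm_num)
  have h4 : 0 ≤ l * Real.log I.nonseedCount :=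
    mul_nonneg h.l_pos.le (by have := h.log_two_le; have := Real.half_lt_log_two; linarith)
  linarith

theorem logFactor_phaseTwo_le (h : I.Admissible ε₀ l₀ ε l) :
    l * Real.log I.nonseedCount + Real.log I.seeds.card + Real.log 4
      ≤ (1 + 4 / l₀) * (l * Real.log (Fintype.card V)) := by
  have h1 := h.log_seeds_le
  have h4 : l * Real.log I.nonseedCount ≤ l * Real.log (Fintype.card V) :=
    mul_le_mul_of_nonneg_left h.log_nonseedCount_le h.l_pos.le
  have h5 := h.log_card_le
  have h6 := h.log_two_le
  have h7 := h.log_nonseedCount_le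
  have h9 : Real.log 4 = 2 * Real.log 2 := by
    rw [show (4 : ℝ) = 2 ^ 2 by norm_num, Real.log_pow]; norm_num
  have h10 := h.log_card_pos
  have h8 : (1 + 4 / l₀) * (l * Real.log (Fintype.card V))
    = l * Real.log (Fintype.card V) + 4 * (1 / l₀ * (l * Real.log (Fintype.card V))) := by ring
  linarith

end Admissible

/-- A bound for the sample size that belongs to the guess `1`, per non-seed node. -/
noncomputable def sizeRate (_ : Attribution V) (ε₀ l₀ ε l : ℝ) : ℝ :=
  (2 + 2 * ε₀) * (1 + 4 / l₀) * (l * Real.log (Fintype.card V) / ε ^ 2)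

namespace Admissible

variable {I} {ε₀ l₀ ε l : ℝ}

theorem sizeRate_nonneg (h : I.Admissible ε₀ l₀ ε l) : 0 ≤ I.sizeRate ε₀ l₀ ε l := by
  have := h.l_pos; have := h.l₀_pos; have := h.ε₀_pos; have := h.log_card_pos
  unfold sizeRate
  positivity

/-- The common bound for the sample sizes of both phases; the summand 1 pays for rounding up. -/
theorem ceil_le (h : I.Admissible ε₀ l₀ ε l) {w x y : ℝ} (hx : 0 < x) (hw0 : 0 ≤ w)
    (hw : w ≤ (2 + 2 * ε₀) / ε ^ 2) (hy0 : 0 ≤ y)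
    (hy : y ≤ (1 + 4 / l₀) * (l * Real.log (Fintype.card V))) :
    (⌈(I.nonseedCount : ℝ) * w / x * y⌉₊ : ℝ)
      ≤ 1 + I.nonseedCount * I.sizeRate ε₀ l₀ ε l / x := by
  have h0 : 0 ≤ (I.nonseedCount : ℝ) * w / x * y := by positivity
  refine (Nat.ceil_lt_add_one h0).le.trans ?_
  rw [add_comm]
  refine add_le_add_right ?_ _
  have h1 : w * y ≤ I.sizeRate ε₀ l₀ ε l := by
    have := h.ε₀_pos
    calc w * y ≤ (2 + 2 * ε₀) / ε ^ 2 * ((1 + 4 / l₀) * (l * Real.log (Fintype.card V))) :=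
          mul_le_mul hw hy hy0 (by positivity)
      _ = _ := by unfold sizeRate; ring
  calc (I.nonseedCount : ℝ) * w / x * y = I.nonseedCount * (w * y) / x := by ring
    _ ≤ _ := by gcongr

theorem sampleCount_le (h : I.Admissible ε₀ l₀ ε l) {x : ℝ} (hx : 0 < x) :
    (I.sampleCount ε l x : ℝ) ≤ 1 + I.nonseedCount * I.sizeRate ε₀ l₀ ε l / x := by
  have he := h.ε_pos
  have := h.ε_le
  have h1 := h.ceil_le (w := (2 + 2 / 3 * ε) / ε ^ 2) hx (by positivity)
    (by gcongr; all_goals linarith) h.logFactor_phaseTwo_nonneg h.logFactor_phaseTwo_le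
  unfold sampleCount
  rwa [← div_div, mul_div_assoc (I.nonseedCount : ℝ)]

theorem sampleCount_anti (h : I.Admissible ε₀ l₀ ε l) {x y : ℝ} (hx : 0 < x) (hxy : x ≤ y) :
    I.sampleCount ε l y ≤ I.sampleCount ε l x := by
  have he := h.ε_pos
  have := h.logFactor_phaseTwo_nonneg
  unfold sampleCount
  gcongr

theorem roundTotal_eq {i : ℕ} (hi : i ≠ 0) : I.roundTotal ε l i
    = ⌈(I.nonseedCount : ℝ) * ((2 + 2 / 3 * (√2 * ε)) / (2 * ε ^ 2)) / I.guess i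
        * I.logFactor l⌉₊ := by
  have h1 : (√2 * ε) ^ 2 = 2 * ε ^ 2 := by rw [mul_pow, Real.sq_sqrt zero_le_two]
  unfold roundTotal
  rw [if_neg hi]
  dsimp only
  rw [h1, ← div_div (_ * _), mul_div_assoc (I.nonseedCount : ℝ), logFactor]

theorem roundTotal_le (h : I.Admissible ε₀ l₀ ε l) {i : ℕ} (hi : i ≠ 0) :
    (I.roundTotal ε l i : ℝ) ≤ 1 + I.nonseedCount * I.sizeRate ε₀ l₀ ε l / I.guess i := by
  have he := h.ε_pos
  have := h.ε_le
  have := Real.sqrt_two_le_two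
  rw [roundTotal_eq hi]
  refine h.ceil_le (I.guess_pos i) (by positivity) ?_ h.logFactor_pos.le h.logFactor_le
  rw [div_le_div_iff₀ (by positivity) (by positivity)]
  have h1 : 2 + 2 / 3 * (√2 * ε) ≤ 2 * (2 + 2 * ε₀) := by nlinarith
  calc _ ≤ 2 * (2 + 2 * ε₀) * ε ^ 2 := by gcongr
    _ = _ := by ring

theorem roundTotal_mono (h : I.Admissible ε₀ l₀ ε l) (i j : ℕ) (hij : i ≤ j) :
    I.roundTotal ε l i ≤ I.roundTotal ε l j := by
  rcases Nat.eq_zero_or_pos i with rfl | hi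
  · simp [roundTotal]
  · have he := h.ε_pos
    have h1 := h.logFactor_pos
    have h2 := I.guess_anti hij
    have h3 := I.guess_pos j
    rw [roundTotal_eq (by omega), roundTotal_eq (by omega)]
    gcongr

/-- The term `2/3 * ε'` of the sample size is dropped: the lower tail does not need it. -/
theorem le_roundTotal (h : I.Admissible ε₀ l₀ ε l) {i : ℕ} (hi : i ≠ 0) :
    (I.nonseedCount : ℝ) * I.logFactor l / (ε ^ 2 * I.guess i) ≤ I.roundTotal ε l i := by
  have he := h.ε_pos
  have h1 := h.logFactor_pos
  have h3 := I.guess_pos i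
  rw [roundTotal_eq hi]
  refine le_trans ?_ (Nat.le_ceil _)
  calc _ = (I.nonseedCount : ℝ) * (2 / (2 * ε ^ 2)) / I.guess i * I.logFactor l := by
        field_simp
    _ ≤ _ := by
        gcongr
        have : 0 ≤ 2 / 3 * (√2 * ε) := by positivity
        linarith

/-! ### The probability of missing the right round -/

/-- The hypothesis on `l`, multiplied by `log n'`. It is what makes the union bound `k * exp
(-logFactor)` at most `1 / n'`. -/
theorem log_add_log_le_logFactor (h : I.Admissible ε₀ l₀ ε l) {k : ℕ}
    (hcond : l ≥ (Real.logb 2 k - Real.logb 2 (Real.logb 2 I.nonseedCount)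
              + Real.logb 2 I.nonseedCount - Real.logb 2 I.seeds.card)
            / Real.logb 2 I.nonseedCount) :
    Real.log k + Real.log I.nonseedCount ≤ I.logFactor l := by
  have h1 := Real.one_le_logb_two_natCast h.two_le
  have h2 := Real.half_lt_log_two
  rw [ge_iff_le, div_le_iff₀ (by linarith)] at hcond
  have h3 : ∀ x : ℝ, Real.logb 2 x * Real.log 2 = Real.log x := fun x => by
    rw [← Real.log_div_log, div_mul_cancel₀ _ (by linarith)]
  have h4 := mul_le_mul_of_nonneg_right hcond (show 0 ≤ Real.log 2 by linarith)
  simp only [sub_mul, add_mul, mul_assoc, h3] at h4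
  unfold logFactor
  linarith

/-- With `e = 1 + ε'` the round stops once the estimate reaches `e * x_j`, while its target `s` is
at least `e² * x_j`. A miss is thus a deviation by a factor `1 / e`, that is `δ = 1 - 1 / e`. -/
theorem missProb_le (h : I.Admissible ε₀ l₀ ε l) {k : ℕ} (hk : 1 ≤ k) (hkT : k ≤ I.seeds.card)
    (hcond : l ≥ (Real.logb 2 k - Real.logb 2 (Real.logb 2 I.nonseedCount)
              + Real.logb 2 I.nonseedCount - Real.logb 2 I.seeds.card)
            / Real.logb 2 I.nonseedCount) {j : ℕ} (hj : j ≠ 0)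
    (hx : I.guess j * (1 + √2 * ε) ^ 2 ≤ I.shapleyKth k) :
    I.missProb ε l k j (I.roundTotal ε l j) (fun _ => 0)
      ≤ ENNReal.ofReal (1 / I.nonseedCount) := by
  classical
  have hε := h.ε_pos
  have hN : (0 : ℝ) < I.nonseedCount := by exact_mod_cast I.nonseedCount_pos
  have hg := I.guess_pos j
  have hlf := h.logFactor_pos
  set e := 1 + √2 * ε with he
  have he0 : 1 ≤ e := by
    have : 0 ≤ √2 * ε := by positivity
    linarith
  set θ := I.roundTotal ε l j with hθ
  set s := I.shapleyKth k with hs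
  have hle := h.le_roundTotal hj
  have hθ0 : (0 : ℝ) < θ := lt_of_lt_of_le (by positivity) hle
  have hδ : 1 - (1 - 1 / e) = 1 / e := by ring
  have hδ' : 1 - 1 / e = √2 * ε / e := by
    rw [he]; field_simp; ring
  have h1 := I.collect_kthLargest_tail_le hk hkT (δ := 1 - 1 / e)
    (a := e * I.guess j * θ / I.nonseedCount)
    (by rw [sub_nonneg, div_le_one (by linarith)]; exact he0)
    (by have : 0 ≤ 1 / e := by positivity
        linarith) θ (by
      rw [hδ, ← hs]
      have : I.guess j * e ^ 2 * (θ / (e * I.nonseedCount))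
        ≤ s * (θ / (e * I.nonseedCount)) := by gcongr
      calc e * I.guess j * θ / I.nonseedCount
          = I.guess j * e ^ 2 * (θ / (e * I.nonseedCount)) := by field_simp
        _ ≤ _ := this
        _ = _ := by field_simp)
  refine le_trans ?_ (h1.trans (ENNReal.ofReal_le_ofReal ?_))
  · refine Comp.mean_mono _ fun est => ?_
    by_cases hst : I.Stops ε l k j est
    · rw [if_pos hst]; exact zero_le
    · have : kthLargest I.seeds est k < e * I.guess j * θ / I.nonseedCount := by
        unfold Stops at hst
        rw [ge_iff_le, not_le, ← mul_div_assoc, div_lt_iff₀ hθ0] at hst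
        rw [lt_div_iff₀ hN, mul_comm]
        exact hst
      rw [if_neg hst, if_pos this]
  -- Here `δ²/2 = ε²/e²`, which cancels against `n' * logFactor / (ε² x_j) ≤ θ` and `x_j * e² ≤ s`.
  · have h2 : I.logFactor l ≤ θ * (s / I.nonseedCount) * ((1 - 1 / e) ^ 2 / 2) := by
      rw [hδ', div_pow, mul_pow, Real.sq_sqrt zero_le_two]
      calc I.logFactor l
          = (I.nonseedCount : ℝ) * I.logFactor l / (ε ^ 2 * I.guess j)
            * (I.guess j * e ^ 2 / I.nonseedCount) * (2 * ε ^ 2 / e ^ 2 / 2) := by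
            field_simp
        _ ≤ _ := by gcongr
    have h3 := h.log_add_log_le_logFactor hcond
    have hk0 : (0 : ℝ) < k := by exact_mod_cast hk
    calc (k : ℝ) * Real.exp (-(θ * (s / I.nonseedCount) * ((1 - 1 / e) ^ 2 / 2)))
        ≤ k * Real.exp (-(Real.log k + Real.log I.nonseedCount)) := by
          gcongr; linarith
      _ = _ := by
          rw [neg_add, Real.exp_add, Real.exp_neg, Real.exp_neg, Real.exp_log hk0,
            Real.exp_log hN]
          field_simp

end Admissible

end Attribution

namespace Attribution

variable {V : Type*} [Fintype V] [DecidableEq V] (I : Attribution V)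

/-! ### The expected running time -/

/-- The bound `unitCost` as a real number. -/
noncomputable def realUnitCost : ℝ :=
  3 * (1 + (I.edgeCount : ℝ) / I.nonseedCount * I.expectedNodeValue)

theorem three_le_realUnitCost : 3 ≤ I.realUnitCost := by
  have := I.expectedNodeValue_nonneg
  have : 0 ≤ (I.edgeCount : ℝ) / I.nonseedCount * I.expectedNodeValue := by positivity
  unfold realUnitCost
  linarith

theorem unitCost_eq : I.unitCost = ENNReal.ofReal I.realUnitCost := by
  have := I.expectedNodeValue_nonneg
  unfold unitCost realUnitCost
  rw [meanWidth_eq, ENNReal.ofReal_mul (p := 3) (by norm_num),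
    ENNReal.ofReal_add zero_le_one (by positivity), ENNReal.ofReal_one]
  norm_num

theorem natCast_mul_unitCost (m : ℕ) :
    (m : ℝ≥0∞) * I.unitCost = ENNReal.ofReal (m * I.realUnitCost) := by
  rw [unitCost_eq, ENNReal.ofReal_mul (Nat.cast_nonneg _), ENNReal.ofReal_natCast]

/-- A bound for the expected cost of phase 2 with the lower bound `LB`. -/
noncomputable def phaseTwoCost (ε l LB : ℝ) : ℝ≥0∞ :=
  2 + 2 * (I.sampleCount ε l LB * I.unitCost)

/-- The leading factor of the running time. -/
noncomputable def leadingFactor (ε l : ℝ) (k : ℕ) : ℝ :=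
  (Fintype.card V : ℝ) * l * Real.log (Fintype.card V) / (I.shapleyKth k * ε ^ 2)

theorem guess_mul_two_pow (i : ℕ) : I.guess i * 2 ^ i = I.nonseedCount := by
  unfold guess
  field_simp

theorem roundTotal_zero (ε l : ℝ) : I.roundTotal ε l 0 = 0 := by
  simp [roundTotal]

/-- If no round of phase 1 has a guess below `s`, then `s` is bounded; otherwise the first such
guess is comparable to `s`. -/
theorem exists_guess {s q A : ℝ} (hs : s ≤ I.nonseedCount) (hs0 : 0 < s) (hq : 1 ≤ q)
    (hqA : q ≤ A) :
    s ≤ 4 * A ∨ ∃ j, j ≠ 0 ∧ j ≤ Nat.log 2 I.nonseedCount - 1 ∧ I.guess j * q ≤ s ∧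
      s ≤ 4 * A * I.guess j := by
  classical
  set M := Nat.log 2 I.nonseedCount - 1 with hM
  by_cases hex : ∃ j, j ≠ 0 ∧ j ≤ M ∧ I.guess j * q ≤ s
  · right
    obtain ⟨h0, h1, h2⟩ := Nat.find_spec hex
    have hmin := fun {m} => Nat.find_min hex (m := m)
    generalize Nat.find hex = j at h0 h1 h2 hmin
    refine ⟨j, h0, h1, h2, ?_⟩
    have hg := I.guess_pos j
    obtain ⟨i, rfl⟩ : ∃ i, j = i + 1 := ⟨j - 1, by omega⟩
    have hhalf : I.guess i = 2 * I.guess (i + 1) := by unfold guess; rw [pow_succ]; field_simp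
    -- Round 1 has no predecessor that failed the test; `x_0 = n' ≥ s` takes its place.
    rcases Nat.eq_zero_or_pos i with hi | hi
    · have h3 : I.guess i = I.nonseedCount := by rw [hi]; simp [guess]
      rw [← h3, hhalf] at hs
      nlinarith
    · have h3 := hmin (show i < i + 1 by omega)
      have h4 : s < I.guess i * q := by
        by_contra! h4
        exact h3 ⟨by omega, by omega, h4⟩
      rw [hhalf] at h4
      nlinarith
  · left
    push Not at hex
    -- The loop ends at round `⌊log₂ n'⌋ - 1`, so the last guess is below 4. This is where the
    -- factor 4 comes from.
    have hlt : (I.nonseedCount : ℝ) < 4 * 2 ^ M := by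
      have h1 : I.nonseedCount < 2 ^ (Nat.log 2 I.nonseedCount + 1) :=
        Nat.lt_pow_succ_log_self one_lt_two _
      have h2 : 2 ^ (Nat.log 2 I.nonseedCount + 1) ≤ 2 ^ (M + 2) :=
        Nat.pow_le_pow_right two_pos (by omega)
      have h3 : I.nonseedCount < 4 * 2 ^ M := by rw [pow_add 2 M 2] at h2; omega
      exact_mod_cast h3
    rcases Nat.eq_zero_or_pos M with h0 | h0
    · rw [h0] at hlt; linarith
    · have h1 := hex M (by omega) le_rfl
      have h2 : I.guess M ≤ 4 := by
        unfold guess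
        rw [div_le_iff₀ (by positivity)]
        exact hlt.le
      nlinarith

namespace Admissible

variable {I} {ε₀ l₀ ε l : ℝ} {k : ℕ}

theorem phaseTwoCost_anti (h : I.Admissible ε₀ l₀ ε l) (x y : ℝ) (hx : 0 < x) (hxy : x ≤ y) :
    I.phaseTwoCost ε l y ≤ I.phaseTwoCost ε l x := by
  have : (I.sampleCount ε l y : ℝ≥0∞) ≤ I.sampleCount ε l x := by
    exact_mod_cast h.sampleCount_anti hx hxy
  unfold phaseTwoCost
  gcongr

theorem phaseTwoCost_le (h : I.Admissible ε₀ l₀ ε l) {x : ℝ} (hx : 0 < x) :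
    I.phaseTwoCost ε l x ≤ ENNReal.ofReal
      (I.realUnitCost * (4 + 2 * (I.nonseedCount * I.sizeRate ε₀ l₀ ε l / x))) := by
  have h1 := h.sampleCount_le hx
  have h2 := I.three_le_realUnitCost
  unfold phaseTwoCost
  rw [natCast_mul_unitCost]
  calc _ = ENNReal.ofReal (2 + 2 * (I.sampleCount ε l x * I.realUnitCost)) := by
        rw [ENNReal.ofReal_add (by norm_num) (by positivity), ENNReal.ofReal_mul (by norm_num)]
        norm_num
    _ ≤ _ := by
        refine ENNReal.ofReal_le_ofReal ?_
        have := mul_le_mul_of_nonneg_right h1 (show 0 ≤ I.realUnitCost by linarith)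
        linarith

/-- The factor that compares the sample sizes with the leading factor. -/
noncomputable def sizeConst (ε₀ l₀ : ℝ) : ℝ := (2 + 2 * ε₀) * (1 + 4 / l₀)

theorem leadingFactor_eq : I.leadingFactor ε l k
    = Fintype.card V / I.shapleyKth k * (l * Real.log (Fintype.card V) / ε ^ 2) := by
  unfold leadingFactor
  rw [div_mul_div_comm, mul_assoc]

theorem ratio_mul_sizeRate_le (h : I.Admissible ε₀ l₀ ε l) (hs : 0 < I.shapleyKth k) :
    (I.nonseedCount : ℝ) / I.shapleyKth k * I.sizeRate ε₀ l₀ ε l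
      ≤ sizeConst ε₀ l₀ * I.leadingFactor ε l k := by
  have h1 : (I.nonseedCount : ℝ) ≤ Fintype.card V := by exact_mod_cast I.nonseedCount_le_card
  have := h.sizeRate_nonneg
  calc _ ≤ (Fintype.card V : ℝ) / I.shapleyKth k * I.sizeRate ε₀ l₀ ε l := by gcongr
    _ = _ := by rw [leadingFactor_eq, sizeRate, sizeConst]; ring

/-- Since `ε ≤ ε₀` and `l₀ ≤ l`, the factor `l / ε²` is bounded below. So terms without it are
absorbed into the leading factor. -/
theorem log_card_le_rate (h : I.Admissible ε₀ l₀ ε l) :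
    Real.log (Fintype.card V)
      ≤ ε₀ ^ 2 / l₀ * (l * Real.log (Fintype.card V) / ε ^ 2) := by
  have h1 := h.log_card_le
  have h2 := h.ε_pos
  have h3 := h.l_pos
  have h4 := h.log_card_pos
  have h5 := h.l₀_pos
  have h6 : ε ^ 2 ≤ ε₀ ^ 2 := pow_le_pow_left₀ h2.le h.ε_le 2
  calc _ ≤ 1 / l₀ * (l * Real.log (Fintype.card V)) := h1
    _ = ε ^ 2 / l₀ * (l * Real.log (Fintype.card V) / ε ^ 2) := by field_simp
    _ ≤ _ := by gcongr

theorem card_div_mul_log_le (h : I.Admissible ε₀ l₀ ε l) (hs : 0 < I.shapleyKth k) :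
    (Fintype.card V : ℝ) / I.shapleyKth k * Real.log (Fintype.card V)
      ≤ ε₀ ^ 2 / l₀ * I.leadingFactor ε l k := by
  calc _ ≤ (Fintype.card V : ℝ) / I.shapleyKth k
        * (ε₀ ^ 2 / l₀ * (l * Real.log (Fintype.card V) / ε ^ 2)) := by
        have := h.log_card_le_rate
        gcongr
    _ = _ := by rw [leadingFactor_eq]; ring

theorem ratio_le (h : I.Admissible ε₀ l₀ ε l) (hs : 0 < I.shapleyKth k) :
    (I.nonseedCount : ℝ) / I.shapleyKth k ≤ 2 * (ε₀ ^ 2 / l₀) * I.leadingFactor ε l k := by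
  have h1 : (I.nonseedCount : ℝ) ≤ Fintype.card V := by exact_mod_cast I.nonseedCount_le_card
  have h2 := h.card_div_mul_log_le hs
  have h3 : 1 ≤ 2 * Real.log (Fintype.card V) := by
    have := h.log_two_le; have := h.log_nonseedCount_le; have := Real.half_lt_log_two
    linarith
  calc (I.nonseedCount : ℝ) / I.shapleyKth k ≤ Fintype.card V / I.shapleyKth k * 1 := by
        rw [mul_one]; gcongr
    _ ≤ Fintype.card V / I.shapleyKth k * (2 * Real.log (Fintype.card V)) := by gcongr
    _ ≤ _ := by linarith

theorem ratio_guess_le {A x : ℝ} (hs : 0 < I.shapleyKth k) (hx : 0 < x)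
    (hA : I.shapleyKth k ≤ 4 * A * x) :
    (I.nonseedCount : ℝ) / x ≤ 4 * A * (I.nonseedCount / I.shapleyKth k) := by
  rw [← mul_div_assoc, div_le_div_iff₀ hx hs]
  have := mul_le_mul_of_nonneg_left hA (Nat.cast_nonneg (α := ℝ) I.nonseedCount)
  linarith

/-- The expected cost of all rounds up to a round whose guess is comparable to the `k`-th largest
Shapley value, and of phase 2 after this. -/
theorem rounds_le (h : I.Admissible ε₀ l₀ ε l) (hs : 0 < I.shapleyKth k)
    (hsN : I.shapleyKth k ≤ I.nonseedCount) {A : ℝ} {j r' : ℕ}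
    (hj : j ≠ 0) (hjA : I.shapleyKth k ≤ 4 * A * I.guess j) {B : ℝ≥0∞}
    (hB : ∀ e, (I.thresholdRounds ε l k r' (j + 1) e).total (I.phaseTwoCost ε l) ≤ B) :
    (I.thresholdRounds ε l k (r' + j) 1 fun _ => 0).total (I.phaseTwoCost ε l)
      ≤ ENNReal.ofReal (I.realUnitCost * ((5 + 8 * A) * (I.nonseedCount / I.shapleyKth k)
          + 20 * A * (I.nonseedCount / I.shapleyKth k * I.sizeRate ε₀ l₀ ε l)))
        + I.missProb ε l k j (I.roundTotal ε l j) (fun _ => 0) * B := by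
  obtain ⟨r, rfl⟩ : ∃ r, j = r + 1 := ⟨j - 1, by omega⟩
  have hmain := I.thresholdRounds_total_le h.ε_pos l k h.phaseTwoCost_anti h.roundTotal_mono hB r 1
    le_rfl (by ring) fun _ => 0
  rw [← add_assoc]
  refine hmain.trans ?_
  rw [I.touched_zero]
  simp only [Nat.sub_self, I.roundTotal_zero, Nat.sub_zero, Nat.cast_zero, add_zero]
  refine add_le_add_left ?_ _
  have hκ := I.three_le_realUnitCost
  set κ := I.realUnitCost with hκdef
  have hS := h.sizeRate_nonneg
  set S := I.sizeRate ε₀ l₀ ε l with hSdef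
  set ρ := (I.nonseedCount : ℝ) / I.shapleyKth k with hρ
  have hρ1 : 1 ≤ ρ := (one_le_div hs).2 hsN
  have hx := I.guess_pos (r + 1)
  have hNx : (I.nonseedCount : ℝ) / I.guess (r + 1) ≤ 4 * A * ρ := ratio_guess_le hs hx hjA
  have hpow : ∀ i, (I.nonseedCount : ℝ) * S / I.guess i = S * 2 ^ i := fun i => by
    rw [← I.guess_mul_two_pow i]
    have := I.guess_pos i
    field_simp
  have hpow' : (2 : ℝ) ^ (r + 1) ≤ 4 * A * ρ := by
    refine le_trans (le_of_eq ?_) hNx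
    rw [eq_div_iff hx.ne', mul_comm]
    exact I.guess_mul_two_pow _
  -- By `roundTotal_le` the totals are at most `1 + S * 2 ^ i`, so their sum is geometric and of the
  -- order of its last term.
  have hsum : ∑ a ∈ Finset.range (r + 1), (1 + (I.roundTotal ε l (1 + a) : ℝ≥0∞) * I.unitCost)
      ≤ ENNReal.ofReal (κ * ((2 + 2 * S) * 2 ^ (r + 1))) := by
    calc _ = ∑ a ∈ Finset.range (r + 1), ENNReal.ofReal (1 + I.roundTotal ε l (1 + a) * κ) := by
          refine Finset.sum_congr rfl fun a _ => ?_
          rw [natCast_mul_unitCost, ENNReal.ofReal_add zero_le_one (by positivity),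
            ENNReal.ofReal_one]
      _ = ENNReal.ofReal (∑ a ∈ Finset.range (r + 1), (1 + I.roundTotal ε l (1 + a) * κ)) :=
          (ENNReal.ofReal_sum_of_nonneg fun a _ => by positivity).symm
      _ ≤ _ := ENNReal.ofReal_le_ofReal ?_
    calc _ ≤ ∑ a ∈ Finset.range (r + 1), κ * ((2 + 2 * S) * 2 ^ a) := by
          refine Finset.sum_le_sum fun a _ => ?_
          have h1 := h.roundTotal_le (i := 1 + a) (by omega)
          rw [hpow, pow_add, pow_one] at h1
          have h2 := mul_le_mul_of_nonneg_right h1 (show 0 ≤ κ by linarith)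
          have h3 : (1 : ℝ) ≤ 2 ^ a := one_le_pow₀ one_le_two
          have h4 : κ * 1 ≤ κ * 2 ^ a := mul_le_mul_of_nonneg_left h3 (by linarith)
          linarith
      _ = κ * ((2 + 2 * S) * (2 ^ (r + 1) - 1)) := by
          rw [← Finset.mul_sum, ← Finset.mul_sum, geom_sum_eq (by norm_num)]
          norm_num
      _ ≤ _ := by gcongr; linarith
  have hθ : (I.roundTotal ε l (r + 1) : ℝ≥0∞) * I.unitCost
      ≤ ENNReal.ofReal (κ * (1 + S * 2 ^ (r + 1))) := by
    rw [natCast_mul_unitCost]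
    refine ENNReal.ofReal_le_ofReal ?_
    have h1 := h.roundTotal_le (i := r + 1) (by omega)
    rw [hpow] at h1
    rw [mul_comm]
    gcongr
  have hphi := h.phaseTwoCost_le hx
  rw [hpow] at hphi
  -- With `P = 2 ^ (r + 1) ≤ 4 * A * ρ` the three terms add up to `κ * (5 + 2 * P + 5 * S * P)`,
  -- which gives the constants 5, `8 * A` and `20 * A`.
  calc _ ≤ ENNReal.ofReal (κ * ((2 + 2 * S) * 2 ^ (r + 1)))
        + ENNReal.ofReal (κ * (1 + S * 2 ^ (r + 1)))
        + ENNReal.ofReal (κ * (4 + 2 * (S * 2 ^ (r + 1)))) := by gcongr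
    _ = ENNReal.ofReal (κ * ((2 + 2 * S) * 2 ^ (r + 1)) + κ * (1 + S * 2 ^ (r + 1))
        + κ * (4 + 2 * (S * 2 ^ (r + 1)))) := by
        rw [ENNReal.ofReal_add (by positivity) (by positivity),
          ENNReal.ofReal_add (by positivity) (by positivity)]
    _ ≤ _ := by
        refine ENNReal.ofReal_le_ofReal ?_
        have h1 := mul_le_mul_of_nonneg_left hpow' hS
        rw [← mul_add, ← mul_add]
        refine mul_le_mul_of_nonneg_left ?_ (by linarith)
        linarith

/-- The expected cost of the rounds after a missed round, and of phase 2 after this, weighted with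
the probability of missing it. -/
theorem miss_mul_le (h : I.Admissible ε₀ l₀ ε l) (hs : 0 < I.shapleyKth k)
    (hsN : I.shapleyKth k ≤ I.nonseedCount) {p : ℝ≥0∞}
    (hp : p ≤ ENNReal.ofReal (1 / I.nonseedCount)) {M r j : ℕ}
    (hM : M ≠ 0) (hML : M ≤ Nat.log 2 I.nonseedCount) (hr : r ≤ Nat.log 2 I.nonseedCount) :
    p * (r * (1 + I.seeds.card)
        + ((I.roundTotal ε l M - I.roundTotal ε l j : ℕ) : ℝ≥0∞) * I.unitCost
        + I.phaseTwoCost ε l 1)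
      ≤ ENNReal.ofReal (I.realUnitCost * (2 * (ε₀ ^ 2 / l₀ * I.leadingFactor ε l k)
          + 5 * (I.nonseedCount / I.shapleyKth k)
          + 3 * (I.nonseedCount / I.shapleyKth k * I.sizeRate ε₀ l₀ ε l))) := by
  have hκ := I.three_le_realUnitCost
  set κ := I.realUnitCost with hκdef
  have hS := h.sizeRate_nonneg
  set S := I.sizeRate ε₀ l₀ ε l with hSdef
  set ρ := (I.nonseedCount : ℝ) / I.shapleyKth k with hρ
  have hρ1 : 1 ≤ ρ := (one_le_div hs).2 hsN
  have hN : (1 : ℝ) ≤ I.nonseedCount := by exact_mod_cast I.nonseedCount_pos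
  have hlog := h.log_card_pos
  have hc : (1 + I.seeds.card : ℝ) ≤ Fintype.card V := by
    have h1 : I.nonseedCount + I.seeds.card = Fintype.card V :=
      Finset.card_sdiff_add_card_eq_card (Finset.subset_univ _)
    have h2 : 1 + I.seeds.card ≤ Fintype.card V := by have := I.nonseedCount_pos; omega
    exact_mod_cast h2
  have hrounds : (r : ℝ≥0∞) * (1 + I.seeds.card)
      ≤ ENNReal.ofReal (2 * (Fintype.card V * Real.log (Fintype.card V))) := by
    have h1 : (r : ℝ) ≤ 2 * Real.log (Fintype.card V) := by
      refine le_trans ?_ h.logb_le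
      refine le_trans ?_ (Real.natLog_le_logb I.nonseedCount 2)
      exact_mod_cast hr
    calc (r : ℝ≥0∞) * (1 + I.seeds.card) = ENNReal.ofReal (r * (1 + I.seeds.card)) := by
          rw [ENNReal.ofReal_mul (Nat.cast_nonneg _), ENNReal.ofReal_natCast,
            ENNReal.ofReal_add zero_le_one (Nat.cast_nonneg _), ENNReal.ofReal_one,
            ENNReal.ofReal_natCast]
      _ ≤ ENNReal.ofReal (2 * Real.log (Fintype.card V) * Fintype.card V) := by gcongr
      _ = _ := by congr 1; ring
  have hsets : ((I.roundTotal ε l M - I.roundTotal ε l j : ℕ) : ℝ≥0∞) * I.unitCost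
      ≤ ENNReal.ofReal (κ * (1 + I.nonseedCount * S)) := by
    rw [natCast_mul_unitCost, mul_comm]
    refine ENNReal.ofReal_le_ofReal (mul_le_mul_of_nonneg_left ?_ (by linarith))
    calc ((I.roundTotal ε l M - I.roundTotal ε l j : ℕ) : ℝ) ≤ I.roundTotal ε l M := by
          exact_mod_cast Nat.sub_le _ _
      _ ≤ 1 + I.nonseedCount * S / I.guess M := h.roundTotal_le hM
      _ ≤ 1 + I.nonseedCount * S := by
          refine add_le_add_right (div_le_self (by positivity) (I.one_le_guess hML)) _
  have hphi := h.phaseTwoCost_le (x := 1) one_pos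
  rw [div_one] at hphi
  calc _ ≤ ENNReal.ofReal (1 / I.nonseedCount)
        * (ENNReal.ofReal (2 * (Fintype.card V * Real.log (Fintype.card V)))
          + ENNReal.ofReal (κ * (1 + I.nonseedCount * S))
          + ENNReal.ofReal (κ * (4 + 2 * (I.nonseedCount * S)))) := by gcongr
    _ = ENNReal.ofReal (1 / I.nonseedCount * (2 * (Fintype.card V * Real.log (Fintype.card V))
          + κ * (1 + I.nonseedCount * S) + κ * (4 + 2 * (I.nonseedCount * S)))) := by
        rw [← ENNReal.ofReal_add (by positivity) (by positivity),
          ← ENNReal.ofReal_add (by positivity) (by positivity),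
          ← ENNReal.ofReal_mul (by positivity)]
    _ ≤ _ := by
        refine ENNReal.ofReal_le_ofReal ?_
        -- The scans of at most `2 log n` rounds cost `O(n log n)`; the miss probability divides
        -- this by `n' ≥ s`.
        have h1 : 1 / (I.nonseedCount : ℝ) * (Fintype.card V * Real.log (Fintype.card V))
            ≤ ε₀ ^ 2 / l₀ * I.leadingFactor ε l k := by
          refine le_trans ?_ (h.card_div_mul_log_le hs)
          rw [← mul_assoc, one_div_mul_eq_div]
          gcongr
        have h2 : 0 ≤ ε₀ ^ 2 / l₀ * I.leadingFactor ε l k := le_trans (by positivity) h1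
        have h3 : 1 / (I.nonseedCount : ℝ) ≤ 1 := (div_le_one (by linarith)).2 hN
        have h4 : S ≤ ρ * S := le_mul_of_one_le_left hS hρ1
        calc _ = 2 * (1 / (I.nonseedCount : ℝ) * (Fintype.card V * Real.log (Fintype.card V)))
              + κ * (5 * (1 / I.nonseedCount) + 3 * S) := by field_simp; ring
          _ ≤ κ * (2 * (ε₀ ^ 2 / l₀ * I.leadingFactor ε l k)) + κ * (5 * ρ + 3 * (ρ * S)) := by
              refine add_le_add ?_ (mul_le_mul_of_nonneg_left ?_ (by linarith))
              · refine le_trans ?_ (le_mul_of_one_le_left (by positivity) (by linarith))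
                linarith
              · linarith
          _ = _ := by ring

/-- The constant of the running time bound, up to the cost of one random set. -/
noncomputable def timeConst (ε₀ l₀ : ℝ) : ℝ :=
  (12 + 8 * (1 + 2 * ε₀) ^ 2) * (2 * (ε₀ ^ 2 / l₀))
    + (28 * (1 + 2 * ε₀) ^ 2 + 3) * sizeConst ε₀ l₀

theorem approxRRset_expectedSteps_le (h : I.Admissible ε₀ l₀ ε l) (hk : 1 ≤ k)
    (hkT : k ≤ I.seeds.card) (hs : 0 < I.shapleyKth k)
    (hcond : l ≥ (Real.logb 2 k - Real.logb 2 (Real.logb 2 I.nonseedCount)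
              + Real.logb 2 I.nonseedCount - Real.logb 2 I.seeds.card)
            / Real.logb 2 I.nonseedCount) :
    (I.approxRRset ε l k).expectedSteps ≤ ENNReal.ofReal
      (I.realUnitCost * (timeConst ε₀ l₀ * I.leadingFactor ε l k)) := by
  have hsN := I.shapleyKth_le hk hkT
  have hκ := I.three_le_realUnitCost
  have hS := h.sizeRate_nonneg
  have hρS := h.ratio_mul_sizeRate_le hs
  have hρQ := h.ratio_le hs
  have hQ : 0 ≤ ε₀ ^ 2 / l₀ * I.leadingFactor ε l k :=
    le_trans (by have := h.log_card_pos; positivity) (h.card_div_mul_log_le hs)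
  set κ := I.realUnitCost with hκdef
  set S := I.sizeRate ε₀ l₀ ε l with hSdef
  set ρ := (I.nonseedCount : ℝ) / I.shapleyKth k with hρ
  have hρ1 : 1 ≤ ρ := (one_le_div hs).2 hsN
  -- A bound for `(1 + ε')²` that depends on `ε₀` only.
  set A := (1 + 2 * ε₀) ^ 2 with hA
  have hA1 : 1 ≤ A := one_le_pow₀ (by have := h.ε₀_pos; linarith)
  have he : 1 ≤ 1 + √2 * ε := by
    have : 0 ≤ √2 * ε := mul_nonneg (Real.sqrt_nonneg _) h.ε_pos.le
    linarith
  have heA : (1 + √2 * ε) ^ 2 ≤ A := by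
    refine pow_le_pow_left₀ (by linarith) (add_le_add_right ?_ _) 2
    exact mul_le_mul Real.sqrt_two_le_two h.ε_le h.ε_pos.le zero_le_two
  refine (I.approxRRset_expectedSteps_le ε l k).trans ?_
  have key : (I.thresholdRounds ε l k (Nat.log 2 I.nonseedCount - 1) 1 fun _ => 0).total
      (I.phaseTwoCost ε l) ≤ ENNReal.ofReal (κ * ((10 + 8 * A) * ρ + (28 * A + 3) * (ρ * S)
        + 2 * (ε₀ ^ 2 / l₀ * I.leadingFactor ε l k))) := by
    have hone : I.shapleyKth k ≤ 4 * A → I.phaseTwoCost ε l 1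
        ≤ ENNReal.ofReal (κ * (4 * ρ + 8 * A * (ρ * S))) := fun hle => by
      refine (h.phaseTwoCost_le one_pos).trans (ENNReal.ofReal_le_ofReal ?_)
      refine mul_le_mul_of_nonneg_left ?_ (by linarith)
      have h1 := ratio_guess_le hs one_pos (hle.trans_eq (mul_one _).symm)
      rw [div_one] at h1 ⊢
      have h2 := mul_le_mul_of_nonneg_right h1 hS
      linarith
    have hρS0 : 0 ≤ ρ * S := mul_nonneg (by linarith) hS
    have hAρ : 0 ≤ A * ρ := by positivity
    have hAρS : 0 ≤ A * (ρ * S) := by positivity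
    have hκρ : 0 ≤ κ := by linarith
    have hρ0 : 0 ≤ ρ := by linarith
    rcases I.exists_guess hsN hs (one_le_pow₀ he) heA with hle | ⟨j, hj0, hjM, hj1, hj2⟩
    -- Here `s` is bounded by a constant, so phase 2 with the default bound 1 is affordable and the
    -- miss probability may be bounded by 1.
    · rcases Nat.eq_zero_or_pos (Nat.log 2 I.nonseedCount - 1) with hM | hM
      · rw [hM, thresholdRounds, Comp.total_ret]
        refine (hone hle).trans (ENNReal.ofReal_le_ofReal ?_)
        refine mul_le_mul_of_nonneg_left ?_ hκρ
        linarith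
      · set M := Nat.log 2 I.nonseedCount - 1 with hMdef
        have hg : 1 ≤ I.guess M := I.one_le_guess (by omega)
        have h1 := h.rounds_le hs hsN (A := A) (j := M) (r' := 0) (by omega)
          (hle.trans (le_mul_of_one_le_right (by linarith) hg)) (B := I.phaseTwoCost ε l 1)
          fun e => by rw [thresholdRounds, Comp.total_ret]
        rw [zero_add] at h1
        refine h1.trans ((add_le_add_right ((mul_le_of_le_one_left zero_le
          (I.missProb_le_one _ _ _ _ _ _)).trans (hone hle)) _).trans ?_)
        rw [← ENNReal.ofReal_add (by positivity) (by positivity), ← mul_add]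
        refine ENNReal.ofReal_le_ofReal (mul_le_mul_of_nonneg_left ?_ hκρ)
        linarith
    -- Here the guess of round `j` is comparable to `s`; the crude bound for the later rounds is
    -- weighted with the miss probability.
    · set M := Nat.log 2 I.nonseedCount - 1 with hMdef
      have h1 := h.rounds_le hs hsN (A := A) (j := j) (r' := M - j) hj0 hj2
        fun e => I.thresholdRounds_total_le_crude h.ε_pos l k h.phaseTwoCost_anti
          h.roundTotal_mono (M := M) (by omega) (M - j) (j + 1) (by omega) (by omega) e
      rw [Nat.sub_add_cancel hjM] at h1
      refine h1.trans ((add_le_add_right (h.miss_mul_le hs hsN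
        (h.missProb_le hk hkT hcond hj0 hj1) (by omega) (by omega) (by omega)) _).trans ?_)
      rw [← ENNReal.ofReal_add (by positivity) (by positivity), ← mul_add]
      refine ENNReal.ofReal_le_ofReal (mul_le_mul_of_nonneg_left ?_ hκρ)
      linarith
  refine (add_le_add_right key 1).trans ?_
  have hρS0 : 0 ≤ ρ * S := mul_nonneg (by linarith) hS
  rw [← ENNReal.ofReal_one, ← ENNReal.ofReal_add zero_le_one (by positivity)]
  refine ENNReal.ofReal_le_ofReal ?_
  -- The initial step is absorbed as one more `κ * ρ`, which turns 10 into 11. The summand with `ε₀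
  -- ^ 2 / l₀` raises it to the 12 of `timeConst`.
  have h1 : 1 ≤ κ * ρ := by nlinarith
  have h2 : (11 + 8 * A) * ρ + (28 * A + 3) * (ρ * S) + 2 * (ε₀ ^ 2 / l₀ * I.leadingFactor ε l k)
      ≤ timeConst ε₀ l₀ * I.leadingFactor ε l k := by
    have h3 := mul_le_mul_of_nonneg_left hρQ (show 0 ≤ 11 + 8 * A by linarith)
    have h4 := mul_le_mul_of_nonneg_left hρS (show 0 ≤ 28 * A + 3 by linarith)
    unfold timeConst
    linarith
  have h3 := mul_le_mul_of_nonneg_left h2 (show 0 ≤ κ by linarith)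
  linarith

end Admissible

end Attribution

/-! ### The running time bound -/

theorem mainTheorem6 (ε₀ l₀ c : ℝ) (hε₀ : 0 < ε₀) (hl₀ : 0 < l₀) (hc : 0 < c) :
    ∃ C : ℝ, 0 < C ∧
      ∀ (V : Type u) [Fintype V] [DecidableEq V] (I : Attribution V) (ε l : ℝ) (k : ℕ),
        0 < ε → ε ≤ ε₀ → l₀ ≤ l → 1 ≤ k → k ≤ I.seeds.card →
        2 ≤ I.nonseedCount → 0 < I.shapleyKth k →
        l ≥ (Real.logb 2 k - Real.logb 2 (Real.logb 2 I.nonseedCount)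
              + Real.logb 2 I.nonseedCount - Real.logb 2 I.seeds.card)
            / Real.logb 2 I.nonseedCount →
        (I.approxRRset ε l k).expectedSteps ≤ ENNReal.ofReal
            (C * ((Fintype.card V : ℝ) * l * Real.log (Fintype.card V) / (I.shapleyKth k * ε ^ 2)
              * ((I.edgeCount : ℝ) / I.nonseedCount * I.expectedNodeValue + 1))) ∧
        (c * I.nonseedCount ≤ I.edgeCount →
          (I.approxRRset ε l k).expectedSteps ≤ ENNReal.ofReal
            (C * ((Fintype.card V : ℝ) * l * Real.log (Fintype.card V) / (I.shapleyKth k * ε ^ 2)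
              * ((I.edgeCount : ℝ) / I.nonseedCount * I.expectedNodeValue)))) := by
  have hD : 0 < Attribution.Admissible.timeConst ε₀ l₀ := by
    unfold Attribution.Admissible.timeConst Attribution.Admissible.sizeConst
    positivity
  set D := Attribution.Admissible.timeConst ε₀ l₀ with hDdef
  -- The factor 3 is that of the cost of one set. The summand 1 suffices for the first bound, and `1
  -- / c` absorbs the `+ 1` in the second.
  refine ⟨3 * D * (1 + 1 / c), by positivity, ?_⟩
  intro V _ _ I ε l k hε hεle hl hk hkT hN hs hcond
  have h : I.Admissible ε₀ l₀ ε l := ⟨hl₀, hl, hε, hεle, hN, hk.trans hkT⟩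
  have hmain := h.approxRRset_expectedSteps_le hk hkT hs hcond
  rw [← hDdef, Attribution.realUnitCost, Attribution.leadingFactor] at hmain
  have hl0 := h.l_pos
  have hlog := h.log_card_pos
  have hval := I.expectedNodeValue_nonneg
  set Q := (Fintype.card V : ℝ) * l * Real.log (Fintype.card V) / (I.shapleyKth k * ε ^ 2)
    with hQdef
  set W := (I.edgeCount : ℝ) / I.nonseedCount * I.expectedNodeValue with hW
  have hQ : 0 ≤ Q := by positivity
  have hW0 : 0 ≤ W := by positivity
  refine ⟨hmain.trans (ENNReal.ofReal_le_ofReal ?_), fun hm =>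
    hmain.trans (ENNReal.ofReal_le_ofReal ?_)⟩
  · calc 3 * (1 + W) * (D * Q) = 3 * D * 1 * (Q * (W + 1)) := by ring
      _ ≤ _ := by
          have : 0 ≤ 1 / c := by positivity
          gcongr
          linarith
  · have hN0 : (0 : ℝ) < I.nonseedCount := by exact_mod_cast I.nonseedCount_pos
    have hm0 : 0 < I.edgeCount := by
      have : (0 : ℝ) < I.edgeCount := lt_of_lt_of_le (by positivity) hm
      exact_mod_cast this
    -- A single node activates at least itself, so `E[U({ṽ})] ≥ 1` and `W ≥ m'/n' ≥ c`.
    have hcW : c ≤ W := by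
      calc c ≤ (I.edgeCount : ℝ) / I.nonseedCount := (le_div_iff₀ hN0).2 hm
        _ ≤ W := le_mul_of_one_le_right (by positivity) (I.one_le_expectedNodeValue hm0)
    have h1 : 1 ≤ 1 / c * W := by
      rw [one_div_mul_eq_div]; exact (one_le_div hc).2 hcW
    calc 3 * (1 + W) * (D * Q) ≤ 3 * (1 / c * W + W) * (D * Q) := by gcongr
      _ = _ := by ring
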